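/- Let $s\ge 2$ be an integer and $\eta\in(0,1]$. For a finite $s$-uniform hypergraph $B$ with set of hyperedges $R[B]$ put $\delta(B)=|B|-\eta\,|R[B]|$; subsets of a hypergraph carry the induced hypergraph structure. For finite $A\subseteq B$ write $A\leqslant_d B$ if $\delta(A')>\delta(A)$ whenever $A\subsetneq A'\subseteq B$; for a finite set $A$ of vertices of an infinite hypergraph $N$ write $A\leqslant_d N$ if $A\leqslant_d B$ for every finite $B\subseteq N$ containing $A$. Let $f:\mathbb R^{\ge 0}\to\mathbb R^{\ge 0}$ be such that $f(0)=0$, $f(1)>0$ and $f(x)\to\infty$ as $x\to\infty$, and let $\mathcal C^f_\eta$ be the class of all finite $s$-uniform hypergraphs $A$ such that $\delta(X)\ge f(|X|)$ for all $X\subseteq A$. Assume that $f$ is good, that is, $(\mathcal C^f_\eta,\leqslant_d)$ has the free amalgamation property: if $A,B,C\in\mathcal C^f_\eta$, $A\leqslant_d B$ and $A\leqslant_d C$, then the free amalgam of $B$ and $C$ over $A$ (glue disjoint copies of $B$ and $C$ along $A$, adding no hyperedges) is in $\mathcal C^f_\eta$. Let $\mathcal M^f_\eta$ be the associated ($\omega$-categorical)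 Hrushovski generic structure, i.e. a countable $s$-uniform hypergraph such that (1) its finite substructures are, up to isomorphism, exactly the members of $\mathcal C^f_\eta$; (2) it is the union of a chain $(A_i)_{i\in\omega}$ of finite sets with $A_i\leqslant_d\mathcal M^f_\eta$; (3) if $A\leqslant_d\mathcal M^f_\eta$ is finite and $A\leqslant_d B\in\mathcal C^f_\eta$, then there is an embedding $g:B\to\mathcal M^f_\eta$ with $g|_A=\mathrm{id}_A$ and $g(B)\leqslant_d\mathcal M^f_\eta$. Let $G=\mathrm{Aut}(\mathcal M^f_\eta)$ and let $\tau_{st}$ be the topology on $G$ whose basic open sets are the cosets $gG_A$, where $G_A$ is the pointwise stabilizer of a finite set $A$ of vertices. If $G$ acts transitively on the vertices of $\mathcal M^f_\eta$, then $(G,\tau_{st})$ is a minimal topological group: it is a Hausdorff topological group, and $G$ admits no Hausdorff group topology strictly coarser than $\tau_{st}$. -/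

import Mathlib

open scoped NNReal

/-- An `s`-uniform hypergraph on the vertex set `V`: a structure with one `s`-ary relation that is
invariant under permutations of the coordinates and holds only for pairwise distinct entries,
recorded by the set of its hyperedges. -/
structure UniformHypergraph (s : ℕ) (V : Type*) where
  edges : Set (Finset V)
  card_of_mem : ∀ e ∈ edges, e.card = s

namespace UniformHypergraph

variable {s : ℕ} {V W : Type*}

/-- The substructure induced on a finite set of vertices. -/
def induce (H : UniformHypergraph s V) (A : Finset V) : UniformHypergraph s A where
  edges := {e | e.map (Function.Embedding.subtype _) ∈ H.edges}
  card_of_mem e he := by simpa using H.card_of_mem _ he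

/-- `φ` is an isomorphism of `H` onto the substructure of `K` induced on the range of `φ`. -/
def IsEmbedding (H : UniformHypergraph s V) (K : UniformHypergraph s W) (φ : V ↪ W) : Prop :=
  ∀ e : Finset V, e ∈ H.edges ↔ e.map φ ∈ K.edges

/-- The predimension `δ(X) = |X| - η |R[X]|` of (the substructure induced on) a finite set `X`. -/
noncomputable def predim (H : UniformHypergraph s V) (η : ℝ) (X : Finset V) : ℝ :=
  (X.card : ℝ) - η * ({e | e ∈ H.edges ∧ e ⊆ X} : Set (Finset V)).ncard

/-- `A ≤ B`: `A ⊆ B` and `δ(A) ≤ δ(B')` whenever `A ⊆ B' ⊆ B`. -/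
def Strong (H : UniformHypergraph s V) (η : ℝ) (A B : Finset V) : Prop :=
  A ⊆ B ∧ ∀ B' : Finset V, A ⊆ B' → B' ⊆ B → H.predim η A ≤ H.predim η B'

/-- `A ≤_d B`: `A ⊆ B` and `δ(A'/A) = δ(A') - δ(A) > 0` whenever `A ⊊ A' ⊆ B`. -/
def DStrong (H : UniformHypergraph s V) (η : ℝ) (A B : Finset V) : Prop :=
  A ⊆ B ∧ ∀ A' : Finset V, A ⊂ A' → A' ⊆ B → 0 < H.predim η A' - H.predim η A

/-- `A ≤_d H` for a finite set `A` of vertices of a possibly infinite hypergraph `H`: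
`A ≤_d B` for all finite `B ⊇ A`. -/
def DClosed (H : UniformHypergraph s V) (η : ℝ) (A : Finset V) : Prop :=
  ∀ B : Finset V, A ⊆ B → H.DStrong η A B

/-- The substructure induced on `X` belongs to the class `C_η`, that is, `∅ ≤ X`. -/
def MemC (H : UniformHypergraph s V) (η : ℝ) (X : Finset V) : Prop :=
  H.Strong η ∅ X

/-- The substructure induced on `X` belongs to the class `C_η^f`. -/
def MemCf (H : UniformHypergraph s V) (η : ℝ) (f : ℝ≥0 → ℝ≥0) (X : Finset V) : Prop :=
  H.MemC η X ∧ ∀ Y ⊆ X, (f (Y.card : ℝ≥0) : ℝ) ≤ H.predim η Y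

/-- `H` is the free amalgam of its substructures on `B` and `C` over the one on `B ∩ C`. -/
def IsFreeAmalgam [Fintype V] [DecidableEq V] (H : UniformHypergraph s V) (B C : Finset V) :
    Prop :=
  B ∪ C = Finset.univ ∧ ∀ e ∈ H.edges, e ⊆ B ∨ e ⊆ C

/-- The automorphism group of a hypergraph, as a permutation group of its vertices. -/
def autGroup (H : UniformHypergraph s V) : Subgroup (Equiv.Perm V) where
  carrier := {g | ∀ e : Finset V, e.map g.toEmbedding ∈ H.edges ↔ e ∈ H.edges}
  one_mem' e := by
    have h : e.map (1 : Equiv.Perm V).toEmbedding = e := Finset.map_refl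
    rw [h]
  mul_mem' {a b} ha hb e := by
    have h : e.map (a * b).toEmbedding = (e.map b.toEmbedding).map a.toEmbedding := by
      rw [Finset.map_map]; rfl
    rw [h]
    exact (ha _).trans (hb e)
  inv_mem' {a} ha e := by
    have h : (e.map (a⁻¹).toEmbedding).map a.toEmbedding = e := by
      ext x; simp [Finset.map_map]
    rw [← ha (e.map (a⁻¹).toEmbedding), h]

end UniformHypergraph

/-- `(C_η^f, ≤_d)` is closed under free amalgamation: if `A ≤_d B` and `A ≤_d C` are members of
`C_η^f`, then their free amalgam over `A` is a member. Finite structures are taken, up to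
isomorphism, on the sets `Fin n`. -/
def HasFreeDAmalgamation (s : ℕ) (η : ℝ) (f : ℝ≥0 → ℝ≥0) : Prop :=
  ∀ (n : ℕ) (D : UniformHypergraph s (Fin n)) (B C : Finset (Fin n)),
    D.IsFreeAmalgam B C → D.MemCf η f B → D.MemCf η f C →
    D.DStrong η (B ∩ C) B → D.DStrong η (B ∩ C) C → D.MemCf η f Finset.univ

/-- Good control functions: `f(0) = 0`, `f(1) > 0`, `f(x) → ∞` as `x → ∞` (which is what
unboundedness means for a convex or a concave function from `[0, ∞)` to `[0, ∞)`), and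
`(C_η^f, ≤_d)` has free amalgamation. -/
structure IsGoodFunction (s : ℕ) (η : ℝ) (f : ℝ≥0 → ℝ≥0) : Prop where
  tendsto : Filter.Tendsto f Filter.atTop Filter.atTop
  map_zero : f 0 = 0
  map_one_pos : 0 < f 1
  amalgamation : HasFreeDAmalgamation s η f

/-- `M` is the generic structure of the class `(C_η^f, ≤_d)`. -/
structure IsHrushovskiGeneric {s : ℕ} {V : Type*} (η : ℝ) (f : ℝ≥0 → ℝ≥0)
    (M : UniformHypergraph s V) : Prop where
  countable : Countable V
  memCf : ∀ X : Finset V, M.MemCf η f X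
  universal : ∀ (n : ℕ) (B : UniformHypergraph s (Fin n)), B.MemCf η f Finset.univ →
    ∃ φ : Fin n ↪ V, B.IsEmbedding M φ
  chain : ∃ A : ℕ → Finset V, Monotone A ∧ (∀ i, M.DClosed η (A i)) ∧ ∀ v, ∃ i, v ∈ A i
  extension : ∀ A : Finset V, M.DClosed η A →
    ∀ (n : ℕ) (B : UniformHypergraph s (Fin n)) (ι : A ↪ Fin n), B.MemCf η f Finset.univ →
    (M.induce A).IsEmbedding B ι → B.DStrong η (Finset.univ.map ι) Finset.univ →
    ∃ φ : Fin n ↪ V, B.IsEmbedding M φ ∧ (∀ a : A, φ (ι a) = a) ∧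
      M.DClosed η (Finset.univ.map φ)

/-- The standard topology `τ_st` on a permutation group `G` of `Ω`: the open sets are the unions of
cosets `g G_A`, where `A ⊆ Ω` is finite and `G_A` is the pointwise stabilizer of `A`. -/
@[reducible] def standardTopology {Ω : Type*} (G : Subgroup (Equiv.Perm Ω)) : TopologicalSpace G :=
  TopologicalSpace.generateFrom
    {U | ∃ (g : G) (A : Finset Ω),
      U = {h : G | ∀ a ∈ A, (h : Equiv.Perm Ω) a = (g : Equiv.Perm Ω) a}}

/-- `(G, τ)` is a minimal topological group: a Hausdorff topological group without strictly
coarser Hausdorff group topology. (In Mathlib's order, `τ ≤ σ` says that `σ` is coarser.) -/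
structure IsMinimalTopologicalGroup (G : Type*) [Group G] (τ : TopologicalSpace G) : Prop where
  isTopologicalGroup : @IsTopologicalGroup G τ _
  t2Space : @T2Space G τ
  eq_of_coarser : ∀ σ : TopologicalSpace G, @IsTopologicalGroup G σ _ → @T2Space G σ →
    τ ≤ σ → σ = τ

open scoped Pointwise Topology

/-!
Let `σ` be a Hausdorff group topology on `G = Aut(M)` coarser than the standard one. It suffices
that point stabilizers are `σ`-neighbourhoods of `1`. By transitivity these are all neighbourhoods
or none is; assume the latter. "Closed" below means `≤_d`-closed in `M`, and every `σ`-neighbourhood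
of `1` contains the pointwise stabilizer of a finite closed set.

*Structure of `M`.* By submodularity of the predimension, closed sets are stable under intersection,
and `≤_d` is transitive. A back-and-forth argument extends isomorphisms between finite closed sets
to automorphisms (`exists_automorphism_eqOn`), and free amalgamation allows one to move a closed set
over a closed subset into free position with respect to any other one (`exists_free_translate`).
By transitivity the singletons are closed (if `V` is infinite; otherwise `G` is finite).

*Moving away.* Every neighbourhood `W` of `1` has infinite orbits (`exists_smul_notMem`), and, using
free translates to treat the points of a finite set one after another, `W` moves any finite set off
any other (`exists_disjoint_smul`).

*From disjointness to freeness.* Disjoint closed sets need not be independent. However, let `w ∈ W`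
move `B'` off itself, where `W` contains the stabilizer of `B'`. Alternating `w` with the stabilizer
of `B'` gives a chain of `n` pairwise disjoint translates of `B'`, each of which separates the first
from the last over a free amalgam (`exists_chain_of_disjoint_smul`). For `B ⊆ B'`, the closure of
`B` and its last translate has predimension at most `2|B|`, hence size bounded in terms of `B`
alone, because `f` tends to infinity. If `n` exceeds this bound, the closure misses a separating
set, and so `B` and its translate are in free position over `∅` (`free_of_separated`). As `n` does
not depend on `B'`, it can be fixed before `W`, and this happens inside a prescribed neighbourhood
(`exists_free_smul`).

*Conclusion.* If `h • B` is in free position with respect to `B`, then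
`G = G_B * h * G_B * h⁻¹ * G_B` (`exists_eq_mul_of_free`). So every neighbourhood of `1` is the whole
group, which contradicts that `σ` is Hausdorff unless `G` is trivial, and then stabilizers are open
anyway.
-/

namespace UniformHypergraph

variable {s : ℕ} {V W : Type*}

/-! ### The predimension and closed sets -/

theorem edges_within_finite (H : UniformHypergraph s V) (X : Finset V) :
    {e | e ∈ H.edges ∧ e ⊆ X}.Finite :=
  X.powerset.finite_toSet.subset fun e he => by simpa using he.2

theorem predim_le_card (H : UniformHypergraph s V) {η : ℝ} (hη : 0 ≤ η) (X : Finset V) :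
    H.predim η X ≤ X.card := by
  have : 0 ≤ η * ({e | e ∈ H.edges ∧ e ⊆ X} : Set (Finset V)).ncard := by positivity
  unfold predim
  linarith

theorem dclosed_iff {H : UniformHypergraph s V} {η : ℝ} {A : Finset V} :
    H.DClosed η A ↔ ∀ X, A ⊂ X → H.predim η A < H.predim η X := by
  constructor
  · intro h X hX
    have := (h X hX.1).2 X hX subset_rfl
    linarith
  · intro h B hB
    exact ⟨hB, fun X hX _ => sub_pos.2 (h X hX)⟩

theorem DClosed.predim_le {H : UniformHypergraph s V} {η : ℝ} {A X : Finset V}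
    (hA : H.DClosed η A) (h : A ⊆ X) :
    H.predim η A ≤ H.predim η X := by
  rcases h.eq_or_ssubset with rfl | h'
  · exact le_rfl
  · exact (dclosed_iff.1 hA X h').le

/-- No hyperedge inside `X ∪ Y` crosses from `X \ Y` to `Y \ X`: the structure on `X ∪ Y` is the
free amalgam of those on `X` and `Y` over `X ∩ Y`. -/
def Splits [DecidableEq V] (H : UniformHypergraph s V) (X Y : Finset V) : Prop :=
  ∀ e ∈ H.edges, e ⊆ X ∪ Y → e ⊆ X ∨ e ⊆ Y

section Predim

variable [DecidableEq V] {H : UniformHypergraph s V} {η : ℝ}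

/-- The predimension is submodular. -/
theorem predim_union_add_predim_inter_le (hη : 0 ≤ η) (X Y : Finset V) :
    H.predim η (X ∪ Y) + H.predim η (X ∩ Y) ≤ H.predim η X + H.predim η Y := by
  have hle : ({e | e ∈ H.edges ∧ e ⊆ X} : Set (Finset V)).ncard
      + ({e | e ∈ H.edges ∧ e ⊆ Y} : Set (Finset V)).ncard
      ≤ ({e | e ∈ H.edges ∧ e ⊆ X ∪ Y} : Set (Finset V)).ncard
      + ({e | e ∈ H.edges ∧ e ⊆ X ∩ Y} : Set (Finset V)).ncard := by
    rw [← Set.ncard_union_add_ncard_inter _ _ (H.edges_within_finite X) (H.edges_within_finite Y)]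
    refine add_le_add (Set.ncard_le_ncard ?_ (H.edges_within_finite _))
      (Set.ncard_le_ncard ?_ (H.edges_within_finite _))
    · rintro e (he | he)
      · exact ⟨he.1, he.2.trans Finset.subset_union_left⟩
      · exact ⟨he.1, he.2.trans Finset.subset_union_right⟩
    · rintro e ⟨h1, h2⟩
      exact ⟨h1.1, Finset.subset_inter h1.2 h2.2⟩
  have hcard : ((X ∪ Y).card : ℝ) + (X ∩ Y).card = X.card + Y.card := by
    exact_mod_cast Finset.card_union_add_card_inter X Y
  have hmul := mul_le_mul_of_nonneg_left (Nat.cast_le (α := ℝ).2 hle) hη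
  push_cast at hmul
  unfold predim
  linarith

theorem Splits.symm {X Y : Finset V} (h : H.Splits X Y) : H.Splits Y X := fun e he hsub =>
  (h e he (by rwa [Finset.union_comm])).symm

/-- On a free amalgam the predimension is modular. -/
theorem Splits.predim_add_eq {L R : Finset V} (h : H.Splits L R) {X : Finset V} (hX : X ⊆ L ∪ R) :
    H.predim η X + H.predim η (X ∩ L ∩ R) = H.predim η (X ∩ L) + H.predim η (X ∩ R) := by
  have hU : X ∩ L ∪ X ∩ R = X := by
    rw [← Finset.inter_union_distrib_left]; exact Finset.inter_eq_left.2 hX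
  have hI : X ∩ L ∩ (X ∩ R) = X ∩ L ∩ R := by
    ext x; simp only [Finset.mem_inter]; tauto
  have hE : ({e | e ∈ H.edges ∧ e ⊆ X} : Set (Finset V)).ncard
      + ({e | e ∈ H.edges ∧ e ⊆ X ∩ L ∩ R} : Set (Finset V)).ncard
      = ({e | e ∈ H.edges ∧ e ⊆ X ∩ L} : Set (Finset V)).ncard
      + ({e | e ∈ H.edges ∧ e ⊆ X ∩ R} : Set (Finset V)).ncard := by
    rw [← Set.ncard_union_add_ncard_inter _ _ (H.edges_within_finite (X ∩ L))
      (H.edges_within_finite (X ∩ R))]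
    congr 2
    · ext e
      constructor
      · rintro ⟨he, heX⟩
        rcases h e he (heX.trans hX) with h' | h'
        · exact Or.inl ⟨he, Finset.subset_inter heX h'⟩
        · exact Or.inr ⟨he, Finset.subset_inter heX h'⟩
      · rintro (⟨he, h'⟩ | ⟨he, h'⟩)
        · exact ⟨he, h'.trans Finset.inter_subset_left⟩
        · exact ⟨he, h'.trans Finset.inter_subset_left⟩
    · ext e
      simp only [Set.mem_ofPred_eq, Set.mem_inter_iff, Finset.subset_inter_iff]
      tauto
  have hcard : (X.card : ℝ) + (X ∩ L ∩ R).card = (X ∩ L).card + (X ∩ R).card := by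
    have := Finset.card_union_add_card_inter (X ∩ L) (X ∩ R)
    rw [hU, hI] at this
    exact_mod_cast this
  have hE' : (({e | e ∈ H.edges ∧ e ⊆ X} : Set (Finset V)).ncard : ℝ)
      + ({e | e ∈ H.edges ∧ e ⊆ X ∩ L ∩ R} : Set (Finset V)).ncard
      = ({e | e ∈ H.edges ∧ e ⊆ X ∩ L} : Set (Finset V)).ncard
      + ({e | e ∈ H.edges ∧ e ⊆ X ∩ R} : Set (Finset V)).ncard := by exact_mod_cast hE
  unfold predim
  linear_combination hcard - η * hE'

/-- Free amalgamation preserves `≤_d`: if `Z₀ ≤_d Z` contains the base `Y ∩ Z` of a free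
amalgam of `Y` and `Z`, then `Y ∪ Z₀ ≤_d Y ∪ Z`. -/
theorem Splits.dstrong_union {Y Z Z₀ : Finset V} (h : H.Splits Y Z) (hbase : Y ∩ Z ⊆ Z₀)
    (hZ : H.DStrong η Z₀ Z) : H.DStrong η (Y ∪ Z₀) (Y ∪ Z) := by
  refine ⟨Finset.union_subset_union_right hZ.1, fun X hX hXU => ?_⟩
  have e1 := h.predim_add_eq (η := η) hXU
  have e2 := h.predim_add_eq (η := η) (Finset.union_subset_union_right (s := Y) hZ.1)
  have hZX : Z₀ ⊂ X ∩ Z := by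
    refine Finset.ssubset_iff_subset_ne.2
      ⟨Finset.subset_inter (Finset.subset_union_right.trans hX.1) hZ.1, fun heq => ?_⟩
    refine hX.2 fun x hx => ?_
    by_cases hxZ : x ∈ Z
    · exact Finset.mem_union_right _ (heq ▸ Finset.mem_inter.2 ⟨hx, hxZ⟩)
    · exact Finset.mem_union_left _ ((Finset.mem_union.1 (hXU hx)).resolve_right hxZ)
  have key := hZ.2 _ hZX Finset.inter_subset_right
  have a1 : X ∩ Y = Y := Finset.inter_eq_right.2 (Finset.subset_union_left.trans hX.1)
  have a2 : (Y ∪ Z₀) ∩ Y = Y := Finset.inter_eq_right.2 Finset.subset_union_left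
  have a3 : (Y ∪ Z₀) ∩ Z = Z₀ := by
    rw [Finset.union_inter_distrib_right, Finset.inter_eq_left.2 hZ.1]
    exact Finset.union_eq_right.2 hbase
  rw [a1] at e1
  rw [a2, a3] at e2
  linarith

theorem DClosed.predim_inter_lt (hη : 0 ≤ η) {A X : Finset V} (hA : H.DClosed η A)
    (hX : ¬ X ⊆ A) : H.predim η (X ∩ A) < H.predim η X := by
  have h1 := predim_union_add_predim_inter_le (H := H) hη X A
  have h2 := dclosed_iff.1 hA (X ∪ A) (Finset.ssubset_iff_subset_ne.2
    ⟨Finset.subset_union_right, fun h => hX (h ▸ Finset.subset_union_left)⟩)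
  linarith

theorem DClosed.predim_inter_le (hη : 0 ≤ η) {A : Finset V} (hA : H.DClosed η A)
    (X : Finset V) : H.predim η (X ∩ A) ≤ H.predim η X := by
  by_cases hX : X ⊆ A
  · rw [Finset.inter_eq_left.2 hX]
  · exact (hA.predim_inter_lt hη hX).le

theorem DStrong.dclosed (hη : 0 ≤ η) {A B : Finset V} (hAB : H.DStrong η A B)
    (hB : H.DClosed η B) : H.DClosed η A := by
  refine dclosed_iff.2 fun X hX => ?_
  by_cases hXB : X ⊆ B
  · have := hAB.2 X hX hXB
    linarith
  · have h1 := hB.predim_inter_lt hη hXB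
    rcases (Finset.subset_inter hX.1 hAB.1).eq_or_ssubset with h | h
    · rwa [← h] at h1
    · have := hAB.2 _ h Finset.inter_subset_right
      linarith

theorem DClosed.inter (hη : 0 ≤ η) {A B : Finset V} (hA : H.DClosed η A)
    (hB : H.DClosed η B) : H.DClosed η (A ∩ B) := by
  refine DStrong.dclosed hη ⟨Finset.inter_subset_left, fun X hX hXA => ?_⟩ hA
  have hXB : X ∩ B = A ∩ B :=
    (Finset.inter_subset_inter_right hXA).antisymm
      (Finset.subset_inter hX.1 Finset.inter_subset_right)
  have := hB.predim_inter_lt hη (X := X) fun h => hX.2 (Finset.subset_inter hXA h)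
  rw [hXB] at this
  linarith

end Predim

/-! ### Transport along embeddings -/

theorem IsEmbedding.trans {U : Type*} {H : UniformHypergraph s U} {K : UniformHypergraph s V}
    {L : UniformHypergraph s W} {φ : U ↪ V} {ψ : V ↪ W} (hφ : H.IsEmbedding K φ)
    (hψ : K.IsEmbedding L ψ) : H.IsEmbedding L (φ.trans ψ) := fun e => by
  rw [← Finset.map_map]; exact (hφ e).trans (hψ _)

theorem induce_isEmbedding (H : UniformHypergraph s V) (A : Finset V) :
    (H.induce A).IsEmbedding H (Function.Embedding.subtype _) := fun _ => Iff.rfl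

/-- The structure pulled back along an injection. -/
def comap (K : UniformHypergraph s W) (φ : V ↪ W) : UniformHypergraph s V where
  edges := {e | e.map φ ∈ K.edges}
  card_of_mem e he := by simpa using K.card_of_mem _ he

theorem comap_isEmbedding (K : UniformHypergraph s W) (φ : V ↪ W) :
    (K.comap φ).IsEmbedding K φ := fun _ => Iff.rfl

section Transport

variable {H : UniformHypergraph s V} {K : UniformHypergraph s W} {φ : V ↪ W} {η : ℝ}
  {f : ℝ≥0 → ℝ≥0}

theorem IsEmbedding.predim_map (hφ : H.IsEmbedding K φ) (X : Finset V) :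
    K.predim η (X.map φ) = H.predim η X := by
  have : ({e | e ∈ K.edges ∧ e ⊆ X.map φ} : Set (Finset W))
      = Finset.map φ '' {e | e ∈ H.edges ∧ e ⊆ X} := by
    ext e
    constructor
    · rintro ⟨he, hs⟩
      obtain ⟨u, hu, rfl⟩ := Finset.subset_map_iff.1 hs
      exact ⟨u, ⟨(hφ u).2 he, hu⟩, rfl⟩
    · rintro ⟨u, ⟨hu, hs⟩, rfl⟩
      exact ⟨(hφ u).1 hu, Finset.map_subset_map.2 hs⟩
  unfold predim
  rw [this, Set.ncard_image_of_injective _ (Finset.map_injective φ), Finset.card_map]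

theorem IsEmbedding.dstrong_map_iff (hφ : H.IsEmbedding K φ) {A B : Finset V} :
    K.DStrong η (A.map φ) (B.map φ) ↔ H.DStrong η A B := by
  unfold DStrong
  rw [Finset.map_subset_map]
  refine and_congr_right fun _ => ⟨fun h X hX hXB => ?_, fun h X hX hXB => ?_⟩
  · have := h (X.map φ) (Finset.map_ssubset_map.2 hX) (Finset.map_subset_map.2 hXB)
    rwa [hφ.predim_map, hφ.predim_map] at this
  · obtain ⟨u, hu, rfl⟩ := Finset.subset_map_iff.1 hXB
    rw [hφ.predim_map, hφ.predim_map]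
    exact h u (Finset.map_ssubset_map.1 hX) hu

theorem IsEmbedding.memCf_map_iff (hφ : H.IsEmbedding K φ) {X : Finset V} :
    K.MemCf η f (X.map φ) ↔ H.MemCf η f X := by
  have h0 : K.predim η ∅ = H.predim η ∅ := by rw [← hφ.predim_map ∅, Finset.map_empty]
  constructor
  · rintro ⟨h1, h2⟩
    refine ⟨⟨Finset.empty_subset _, fun Y _ hY => ?_⟩, fun Y hY => ?_⟩
    · have := h1.2 (Y.map φ) (Finset.empty_subset _) (Finset.map_subset_map.2 hY)
      rwa [hφ.predim_map, h0] at this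
    · have := h2 (Y.map φ) (Finset.map_subset_map.2 hY)
      rwa [hφ.predim_map, Finset.card_map] at this
  · rintro ⟨h1, h2⟩
    refine ⟨⟨Finset.empty_subset _, fun Y _ hY => ?_⟩, fun Y hY => ?_⟩
    · obtain ⟨u, hu, rfl⟩ := Finset.subset_map_iff.1 hY
      rw [hφ.predim_map, h0]
      exact h1.2 u (Finset.empty_subset _) hu
    · obtain ⟨u, hu, rfl⟩ := Finset.subset_map_iff.1 hY
      rw [hφ.predim_map, Finset.card_map]
      exact h2 u hu

end Transport

/-- Free amalgamation for structures on arbitrary finite types. -/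
theorem memCf_univ_of_splits {η : ℝ} {f : ℝ≥0 → ℝ≥0} (ham : HasFreeDAmalgamation s η f)
    {T : Type*} [Fintype T] [DecidableEq T] (D : UniformHypergraph s T) {B C : Finset T}
    (hU : B ∪ C = Finset.univ) (hs : D.Splits B C) (hB : D.MemCf η f B) (hC : D.MemCf η f C)
    (hIB : D.DStrong η (B ∩ C) B) (hIC : D.DStrong η (B ∩ C) C) :
    D.MemCf η f Finset.univ := by
  set e := Fintype.equivFin T
  have hφ : (D.comap e.symm.toEmbedding).IsEmbedding D e.symm.toEmbedding :=
    comap_isEmbedding _ _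
  have hmap : ∀ X : Finset T, (X.map e.toEmbedding).map e.symm.toEmbedding = X := fun X => by
    ext x; simp [Finset.map_map]
  have key := ham _ (D.comap e.symm.toEmbedding) (B.map e.toEmbedding) (C.map e.toEmbedding)
    ⟨by rw [← Finset.map_union, hU, Finset.map_univ_equiv], fun E hE => ?_⟩
    (by rw [← hφ.memCf_map_iff, hmap]; exact hB) (by rw [← hφ.memCf_map_iff, hmap]; exact hC)
    (by rw [← Finset.map_inter, ← hφ.dstrong_map_iff, hmap, hmap]; exact hIB)
    (by rw [← Finset.map_inter, ← hφ.dstrong_map_iff, hmap, hmap]; exact hIC)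
  · rw [← hφ.memCf_map_iff, Finset.map_univ_equiv] at key
    exact key
  · have := hs _ hE (by rw [hU]; exact Finset.subset_univ _)
    rw [← hmap B, ← hmap C, Finset.map_subset_map, Finset.map_subset_map] at this
    exact this

section Glue

variable {X Y T : Type*} {H : UniformHypergraph s X} {K : UniformHypergraph s Y} {i : X ↪ T}
  {j : Y ↪ T}

/-- The structure on `T` whose hyperedges are those of `H` and of `K`, where the vertex sets of `H`
and `K` are identified with subsets of `T`. -/
def glue (H : UniformHypergraph s X) (K : UniformHypergraph s Y) (i : X ↪ T) (j : Y ↪ T) :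
    UniformHypergraph s T where
  edges := Finset.map i '' H.edges ∪ Finset.map j '' K.edges
  card_of_mem := by
    rintro _ (⟨e, he, rfl⟩ | ⟨e, he, rfl⟩)
    · simpa using H.card_of_mem e he
    · simpa using K.card_of_mem e he

theorem glue_isEmbedding_left
    (h : ∀ a b, Finset.map i a = Finset.map j b → (a ∈ H.edges ↔ b ∈ K.edges)) :
    H.IsEmbedding (glue H K i j) i := by
  refine fun e => ⟨fun he => Or.inl ⟨e, he, rfl⟩, ?_⟩
  rintro (⟨u, hu, hue⟩ | ⟨u, hu, hue⟩)
  · rwa [← Finset.map_injective i hue]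
  · exact (h e u hue.symm).2 hu

theorem glue_isEmbedding_right
    (h : ∀ a b, Finset.map i a = Finset.map j b → (a ∈ H.edges ↔ b ∈ K.edges)) :
    K.IsEmbedding (glue H K i j) j := by
  refine fun e => ⟨fun he => Or.inr ⟨e, he, rfl⟩, ?_⟩
  rintro (⟨u, hu, hue⟩ | ⟨u, hu, hue⟩)
  · exact (h u e hue).1 hu
  · rwa [← Finset.map_injective j hue]

theorem glue_splits [Fintype X] [Fintype Y] [DecidableEq T] :
    (glue H K i j).Splits (Finset.univ.map j) (Finset.univ.map i) := by
  rintro _ (⟨u, -, rfl⟩ | ⟨u, -, rfl⟩) -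
  · exact Or.inr (Finset.map_subset_map.2 (Finset.subset_univ _))
  · exact Or.inl (Finset.map_subset_map.2 (Finset.subset_univ _))

end Glue

/-! ### The action of the automorphism group -/

section Action

variable {M : UniformHypergraph s V} {η : ℝ} {f : ℝ≥0 → ℝ≥0}

theorem autGroup_isEmbedding (g : M.autGroup) :
    M.IsEmbedding M (g : Equiv.Perm V).toEmbedding := fun e => (g.2 e).symm

variable [DecidableEq V]

theorem map_eq_smul (g : M.autGroup) (X : Finset V) :
    X.map (g : Equiv.Perm V).toEmbedding = g • X := by
  ext x
  rw [Finset.mem_map, Finset.mem_smul_finset]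
  rfl

theorem smul_mem_edges_iff (g : M.autGroup) {e : Finset V} : g • e ∈ M.edges ↔ e ∈ M.edges := by
  rw [← map_eq_smul]; exact g.2 e

theorem predim_smul (g : M.autGroup) (X : Finset V) : M.predim η (g • X) = M.predim η X := by
  rw [← map_eq_smul]; exact (autGroup_isEmbedding g).predim_map X

theorem disjoint_smul_finset (g : M.autGroup) {X Y : Finset V} (h : Disjoint X Y) :
    Disjoint (g • X) (g • Y) := by
  rw [Finset.disjoint_iff_inter_eq_empty] at h ⊢
  rw [← Finset.smul_finset_inter, h, Finset.smul_finset_empty]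

theorem DClosed.smul {A : Finset V} (hA : M.DClosed η A) (g : M.autGroup) :
    M.DClosed η (g • A) := by
  refine dclosed_iff.2 fun X hX => ?_
  rw [predim_smul, ← predim_smul g⁻¹ X]
  refine dclosed_iff.1 hA _ ?_
  rw [Finset.ssubset_iff_subset_ne] at hX ⊢
  refine ⟨Finset.smul_finset_subset_iff.1 hX.1, fun h => hX.2 ?_⟩
  rw [h, smul_inv_smul]

theorem Splits.smul {X Y : Finset V} (h : M.Splits X Y) (g : M.autGroup) :
    M.Splits (g • X) (g • Y) := by
  intro e he hsub
  have h1 : g⁻¹ • e ∈ M.edges := (smul_mem_edges_iff _).2 he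
  rw [← Finset.smul_finset_union, Finset.subset_smul_finset_iff] at hsub
  simpa only [Finset.subset_smul_finset_iff] using h _ h1 hsub

end Action

end UniformHypergraph

namespace UniformHypergraph

variable {s : ℕ} {V : Type*} {M : UniformHypergraph s V} {η : ℝ} {f : ℝ≥0 → ℝ≥0}

/-! ### Homogeneity of the generic structure -/

theorem univ_map_subtype (A : Finset V) :
    (Finset.univ : Finset A).map (Function.Embedding.subtype _) = A := by
  ext x; simp

theorem exists_map_subtype_eq {A e : Finset V} (he : e ⊆ A) :
    ∃ u : Finset A, u.map (Function.Embedding.subtype _) = e := by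
  obtain ⟨u, -, hu⟩ := Finset.subset_map_iff.1 (he.trans (univ_map_subtype A).ge)
  exact ⟨u, hu.symm⟩

theorem memCf_induce_univ (hM : IsHrushovskiGeneric η f M) (A : Finset V) :
    (M.induce A).MemCf η f Finset.univ := by
  rw [← (M.induce_isEmbedding A).memCf_map_iff, univ_map_subtype]
  exact hM.memCf A

theorem exists_dclosed_superset [DecidableEq V] (hM : IsHrushovskiGeneric η f M) (F : Finset V) :
    ∃ A, F ⊆ A ∧ M.DClosed η A := by
  obtain ⟨A, hmono, hcl, hcov⟩ := hM.chain
  induction F using Finset.induction_on with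
  | empty => exact ⟨A 0, Finset.empty_subset _, hcl 0⟩
  | insert v F _ _ =>
    choose n hn using hcov
    refine ⟨A ((insert v F).sup n), fun x hx => ?_, hcl _⟩
    exact hmono (Finset.le_sup (f := n) hx) (hn x)

/-- Only boundedly many points fit into a set of bounded predimension. -/
theorem exists_card_lt_of_predim_le (hM : IsHrushovskiGeneric η f M)
    (hf : Filter.Tendsto f Filter.atTop Filter.atTop) (c : ℕ) :
    ∃ n : ℕ, ∀ X : Finset V, M.predim η X ≤ c → X.card < n := by
  obtain ⟨a, ha⟩ := Filter.eventually_atTop.1 (hf.eventually_ge_atTop ((c : ℝ≥0) + 1))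
  refine ⟨⌈a⌉₊, fun X hX => ?_⟩
  by_contra! hcard
  have h1 : (c : ℝ≥0) + 1 ≤ f X.card := ha _ (Nat.ceil_le.1 hcard)
  have h2 := (hM.memCf X).2 X subset_rfl
  have h3 : ((c : ℝ) + 1) ≤ (f X.card : ℝ) := by exact_mod_cast h1
  linarith

/-- The extension property for structures on arbitrary finite types. -/
theorem exists_extension (hM : IsHrushovskiGeneric η f M) {A : Finset V} (hA : M.DClosed η A)
    {T : Type*} [Fintype T] {B : UniformHypergraph s T} {ι : A ↪ T}
    (hB : B.MemCf η f Finset.univ) (hι : (M.induce A).IsEmbedding B ι)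
    (hs : B.DStrong η (Finset.univ.map ι) Finset.univ) :
    ∃ φ : T ↪ V, B.IsEmbedding M φ ∧ (∀ a : A, φ (ι a) = a) ∧
      M.DClosed η (Finset.univ.map φ) := by
  classical
  set e := Fintype.equivFin T
  have hφ : (B.comap e.symm.toEmbedding).IsEmbedding B e.symm.toEmbedding :=
    comap_isEmbedding _ _
  have hmap : ∀ X : Finset T, (X.map e.toEmbedding).map e.symm.toEmbedding = X := fun X => by
    ext x; simp [Finset.map_map]
  have he : B.IsEmbedding (B.comap e.symm.toEmbedding) e.toEmbedding := fun X => by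
    rw [hφ, hmap]
  obtain ⟨φ, h1, h2, h3⟩ := hM.extension A hA _ (B.comap e.symm.toEmbedding)
    (ι.trans e.toEmbedding) (by rw [← hφ.memCf_map_iff, Finset.map_univ_equiv]; exact hB)
    (hι.trans he)
    (by rw [← Finset.map_map, ← hφ.dstrong_map_iff, hmap, Finset.map_univ_equiv]; exact hs)
  refine ⟨e.toEmbedding.trans φ, he.trans h1, h2, ?_⟩
  rwa [← Finset.map_map, Finset.map_univ_equiv]

variable [DecidableEq V]

/-- A finite partial isomorphism between closed subsets of `M`. -/
structure IsClosedPartialIso (M : UniformHypergraph s V) (η : ℝ) (p : PartialEquiv V V) :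
    Prop where
  source : ∃ A : Finset V, (A : Set V) = p.source ∧ M.DClosed η A
  target : ∃ B : Finset V, (B : Set V) = p.target ∧ M.DClosed η B
  mem_edges_iff : ∀ e : Finset V, (e : Set V) ⊆ p.source → (e ∈ M.edges ↔ e.image p ∈ M.edges)

theorem image_image_of_rightInv {e : Finset V} {φ χ : V → V} (h : ∀ x ∈ e, φ (χ x) = x) :
    (e.image χ).image φ = e := by
  rw [Finset.image_image]
  exact (Finset.image_congr fun x hx => h x hx).trans Finset.image_id

theorem IsClosedPartialIso.symm {p : PartialEquiv V V} (hp : IsClosedPartialIso M η p) :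
    IsClosedPartialIso M η p.symm := by
  refine ⟨hp.target, hp.source, fun e he => ?_⟩
  rw [hp.mem_edges_iff (e.image p.symm), image_image_of_rightInv fun x hx => p.right_inv (he hx)]
  rw [Finset.coe_image]
  rintro _ ⟨x, hx, rfl⟩
  exact p.map_target (he hx)

theorem isClosedPartialIso_of_injOn [Nonempty V] {P : Finset V} {φ : V → V}
    (hP : M.DClosed η P) (hinj : Set.InjOn φ P)
    (hedges : ∀ e ⊆ P, (e ∈ M.edges ↔ e.image φ ∈ M.edges)) (hcl : M.DClosed η (P.image φ)) :
    IsClosedPartialIso M η (hinj.toPartialEquiv φ P) :=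
  ⟨⟨P, rfl, hP⟩, ⟨P.image φ, Finset.coe_image, hcl⟩,
    fun e he => hedges e (Finset.coe_subset.1 he)⟩

theorem image_dite_eq_map {A : Finset V} (ψ : A ↪ V) {e : Finset V} {u : Finset A}
    (hu : u.map (Function.Embedding.subtype _) = e) :
    e.image (fun x => if h : x ∈ A then ψ ⟨x, h⟩ else x) = u.map ψ := by
  subst hu
  ext x
  simp only [Finset.mem_image, Finset.mem_map, Function.Embedding.coe_subtype]
  constructor
  · rintro ⟨_, ⟨y, hy, rfl⟩, rfl⟩
    exact ⟨y, hy, by simp⟩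
  · rintro ⟨y, hy, rfl⟩
    exact ⟨y, ⟨y, hy, rfl⟩, by simp⟩

/-- An embedding of the structure on `A`, extended to a map on all vertices. -/
theorem injOn_and_image_mem_edges_iff {A : Finset V} {ψ : A ↪ V} (hψ : (M.induce A).IsEmbedding M ψ) :
    Set.InjOn (fun x => if h : x ∈ A then ψ ⟨x, h⟩ else x) A ∧
    (∀ e ⊆ A, (e ∈ M.edges ↔
      e.image (fun x => if h : x ∈ A then ψ ⟨x, h⟩ else x) ∈ M.edges)) ∧
    A.image (fun x => if h : x ∈ A then ψ ⟨x, h⟩ else x) = Finset.univ.map ψ := by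
  refine ⟨fun x hx y hy hxy => ?_, fun e he => ?_, image_dite_eq_map ψ (univ_map_subtype A)⟩
  · have hx' : x ∈ A := hx
    have hy' : y ∈ A := hy
    simp only [hx', hy', dif_pos] at hxy
    exact congrArg Subtype.val (ψ.injective hxy)
  · obtain ⟨u, hu⟩ := exists_map_subtype_eq he
    rw [image_dite_eq_map ψ hu, ← hu]
    exact hψ u

/-- The forth step: a closed partial isomorphism extends to any further vertex. -/
theorem IsClosedPartialIso.exists_extension_source (hM : IsHrushovskiGeneric η f M)
    {p : PartialEquiv V V} (hp : IsClosedPartialIso M η p) (v : V) :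
    ∃ q, IsClosedPartialIso M η q ∧ p.source ⊆ q.source ∧ Set.EqOn p q p.source ∧
      v ∈ q.source := by
  have : Nonempty V := ⟨v⟩
  obtain ⟨A, hAp, hA⟩ := hp.source
  obtain ⟨B, hBp, hB⟩ := hp.target
  obtain ⟨A', hAA', hA'⟩ := exists_dclosed_superset hM (insert v A)
  have hsub : A ⊆ A' := (Finset.subset_insert _ _).trans hAA'
  have memA : ∀ x, x ∈ A ↔ x ∈ p.source := fun x => by rw [← hAp, Finset.mem_coe]
  have memB : ∀ x, x ∈ B ↔ x ∈ p.target := fun x => by rw [← hBp, Finset.mem_coe]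
  let ι : B ↪ A' := ⟨fun b => ⟨p.symm b, hsub ((memA _).2 (p.map_target ((memB _).1 b.2)))⟩,
    fun b c hbc => Subtype.ext
      (p.symm.injOn ((memB _).1 b.2) ((memB _).1 c.2) (congrArg Subtype.val hbc))⟩
  have hιmap : ∀ u : Finset B, (u.map ι).map (Function.Embedding.subtype _)
      = (u.map (Function.Embedding.subtype _)).image p.symm := fun u => by
    ext x
    simp only [Finset.mem_map, Finset.mem_image, Function.Embedding.coe_subtype]
    constructor
    · rintro ⟨_, ⟨b, hb, rfl⟩, rfl⟩
      exact ⟨b, ⟨b, hb, rfl⟩, rfl⟩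
    · rintro ⟨_, ⟨b, hb, rfl⟩, rfl⟩
      exact ⟨ι b, ⟨b, hb, rfl⟩, rfl⟩
  have hιe : (M.induce B).IsEmbedding (M.induce A') ι := fun u => by
    rw [M.induce_isEmbedding B u, M.induce_isEmbedding A' (u.map ι), hιmap]
    refine hp.symm.mem_edges_iff _ fun x hx => ?_
    obtain ⟨b, -, rfl⟩ := Finset.mem_map.1 (Finset.mem_coe.1 hx)
    exact (memB _).1 b.2
  have hιs : (M.induce A').DStrong η (Finset.univ.map ι) Finset.univ := by
    rw [← (M.induce_isEmbedding A').dstrong_map_iff, univ_map_subtype, hιmap, univ_map_subtype]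
    convert hA A' hsub
    ext x
    rw [Finset.mem_image, memA]
    constructor
    · rintro ⟨b, hb, rfl⟩
      exact p.map_target ((memB _).1 hb)
    · exact fun hx => ⟨p x, (memB _).2 (p.map_source hx), p.left_inv hx⟩
  obtain ⟨ψ, h1, h2, h3⟩ := exists_extension hM hB (memCf_induce_univ hM A') hιe hιs
  obtain ⟨hinj, hedge, him⟩ := injOn_and_image_mem_edges_iff h1
  refine ⟨_, isClosedPartialIso_of_injOn hA' hinj hedge (him ▸ h3), ?_, fun x hx => ?_,
    hAA' (Finset.mem_insert_self _ _)⟩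
  · rw [← hAp]; exact Finset.coe_subset.2 hsub
  · have hxA' : x ∈ A' := hsub ((memA x).2 hx)
    have := h2 ⟨p x, (memB _).2 (p.map_source hx)⟩
    have hι : ι ⟨p x, (memB _).2 (p.map_source hx)⟩ = ⟨x, hxA'⟩ :=
      Subtype.ext (p.left_inv hx)
    rw [hι] at this
    exact this.symm.trans (by simp [Set.InjOn.toPartialEquiv, Set.BijOn.toPartialEquiv, hxA'])

/-- The back-and-forth step: the forth step applied to a partial isomorphism and to the inverse of
the result. -/
theorem IsClosedPartialIso.exists_extension_source_target (hM : IsHrushovskiGeneric η f M)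
    {p : PartialEquiv V V} (hp : IsClosedPartialIso M η p) (v : V) :
    ∃ q, IsClosedPartialIso M η q ∧ p.source ⊆ q.source ∧ Set.EqOn p q p.source ∧
      v ∈ q.source ∧ v ∈ q.target := by
  obtain ⟨q, hq, h1, h2, h3⟩ := hp.exists_extension_source hM v
  obtain ⟨r, hr, k1, k2, k3⟩ := hq.symm.exists_extension_source hM v
  have key : ∀ x ∈ q.source, x ∈ r.target ∧ q x = r.symm x := fun x hx => by
    have hqx : q x ∈ q.symm.source := q.map_source hx
    have : r (q x) = x := (k2 hqx).symm.trans (q.left_inv hx)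
    exact ⟨this ▸ r.map_source (k1 hqx), by
      conv_rhs => rw [← this]
      exact (r.left_inv (k1 hqx)).symm⟩
  exact ⟨r.symm, hr.symm, fun x hx => (key x (h1 hx)).1,
    fun x hx => (h2 hx).trans (key x (h1 hx)).2, (key v h3).1, k3⟩

/-- The generic structure is homogeneous for closed finite subsets, by back-and-forth. -/
theorem exists_automorphism_eqOn (hM : IsHrushovskiGeneric η f M) {P : Finset V} {φ : V → V}
    (hP : M.DClosed η P) (hinj : Set.InjOn φ P)
    (hedges : ∀ e ⊆ P, (e ∈ M.edges ↔ e.image φ ∈ M.edges)) (hcl : M.DClosed η (P.image φ)) :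
    ∃ g : M.autGroup, ∀ x ∈ P, g • x = φ x := by
  rcases isEmpty_or_nonempty V with hV | hV
  · exact ⟨1, fun x => (hV.false x).elim⟩
  have := hM.countable
  obtain ⟨enum, henum⟩ := exists_surjective_nat V
  choose idx hidx using henum
  choose next hnext hsrc heq hvs hvt using
    fun (p : {p : PartialEquiv V V // IsClosedPartialIso M η p}) (v : V) =>
      p.2.exists_extension_source_target hM v
  let seq : ℕ → {p : PartialEquiv V V // IsClosedPartialIso M η p} := fun n =>
    Nat.rec ⟨_, isClosedPartialIso_of_injOn hP hinj hedges hcl⟩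
      (fun n p => ⟨next p (enum n), hnext p (enum n)⟩) n
  have hle : ∀ n m, n ≤ m → (seq n).1.source ⊆ (seq m).1.source ∧
      Set.EqOn (seq n).1 (seq m).1 (seq n).1.source := by
    intro n m hnm
    induction m, hnm using Nat.le_induction with
    | base => exact ⟨subset_rfl, fun _ _ => rfl⟩
    | succ m _ ih =>
      exact ⟨ih.1.trans (hsrc (seq m) (enum m)),
        fun x hx => (ih.2 hx).trans (heq (seq m) (enum m) (ih.1 hx))⟩
  have hsource : ∀ v, v ∈ (seq (idx v + 1)).1.source := fun v => by
    have : enum (idx v) ∈ (seq (idx v + 1)).1.source := hvs (seq (idx v)) (enum (idx v))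
    rwa [hidx] at this
  have htarget : ∀ v, v ∈ (seq (idx v + 1)).1.target := fun v => by
    have : enum (idx v) ∈ (seq (idx v + 1)).1.target := hvt (seq (idx v)) (enum (idx v))
    rwa [hidx] at this
  let g : V → V := fun v => (seq (idx v + 1)).1 v
  have hg : ∀ n, Set.EqOn g (seq n).1 (seq n).1.source := fun n x hx => by
    rcases le_total n (idx x + 1) with h | h
    · exact ((hle _ _ h).2 hx).symm
    · exact (hle _ _ h).2 (hsource x)
  have hcover : ∀ e : Finset V, ∃ n, (e : Set V) ⊆ (seq n).1.source := fun e =>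
    ⟨e.sup fun v => idx v + 1, fun x hx =>
      (hle _ _ (Finset.le_sup (f := fun v => idx v + 1) hx)).1 (hsource x)⟩
  -- `g` is the union of the chain `seq`, which exhausts `V` on both sides.
  have hbij : Function.Bijective g := by
    constructor
    · intro x y hxy
      obtain ⟨n, hn⟩ := hcover {x, y}
      have hx : x ∈ (seq n).1.source := hn (by simp)
      have hy : y ∈ (seq n).1.source := hn (by simp)
      rw [hg n hx, hg n hy] at hxy
      exact (seq n).1.injOn hx hy hxy
    · intro y
      have hy := htarget y
      exact ⟨(seq (idx y + 1)).1.symm y,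
        (hg (idx y + 1) ((seq (idx y + 1)).1.map_target hy)).trans ((seq (idx y + 1)).1.right_inv hy)⟩
  refine ⟨⟨Equiv.ofBijective g hbij, fun e => ?_⟩, fun x hx => hg 0 hx⟩
  obtain ⟨n, hn⟩ := hcover e
  rw [(seq n).2.mem_edges_iff e hn, Finset.map_eq_image]
  exact iff_of_eq (congrArg (· ∈ M.edges) (Finset.image_congr fun x hx => hg n (hn hx)))

/-- Free amalgamation inside the generic structure: over a closed set `Q`, any closed set `P ⊇ Q`
can be moved by an automorphism into free position over `Q` from any closed `Z ⊇ Q`. -/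
theorem exists_free_translate (hM : IsHrushovskiGeneric η f M) (hη : 0 ≤ η)
    (ham : HasFreeDAmalgamation s η f) {Q P Z : Finset V} (hQ : M.DClosed η Q)
    (hP : M.DClosed η P) (hZ : M.DClosed η Z) (hQP : Q ⊆ P) (hQZ : Q ⊆ Z) :
    ∃ g : M.autGroup, (∀ q ∈ Q, g • q = q) ∧ g • P ∩ Z = Q ∧ M.DClosed η (g • P ∪ Z) ∧
      M.Splits (g • P) Z := by
  -- The free amalgam `D` of `P` and `Z` over `Q`, on the disjoint union `T` of `Z` and `P \ Q`.
  let T := Z ⊕ {x // x ∈ P ∧ x ∉ Q}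
  have : Fintype {x // x ∈ P ∧ x ∉ Q} := Fintype.subtype (P \ Q) (by simp)
  let i : Z ↪ T := ⟨Sum.inl, Sum.inl_injective⟩
  let j₀ : P → T := fun p => if h : (p : V) ∈ Q then Sum.inl ⟨p, hQZ h⟩ else Sum.inr ⟨p, p.2, h⟩
  let π : T → V := Sum.elim (fun z => z) fun p => p
  have hπj₀ : ∀ p, π (j₀ p) = p := fun p => by
    by_cases h : (p : V) ∈ Q
    · rw [show j₀ p = Sum.inl ⟨p, hQZ h⟩ from dif_pos h]; rfl
    · rw [show j₀ p = Sum.inr ⟨p, p.2, h⟩ from dif_neg h]; rfl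
  let j : P ↪ T := ⟨j₀, fun a b hab => Subtype.ext (by rw [← hπj₀ a, hab, hπj₀])⟩
  have hπj : ∀ p, π (j p) = p := hπj₀
  have hjl : ∀ (p : P) (h : (p : V) ∈ Q), j p = i ⟨p, hQZ h⟩ := fun p h => dif_pos h
  have hjr : ∀ (p : P) (h : (p : V) ∉ Q), j p = Sum.inr ⟨p, p.2, h⟩ := fun p h => dif_neg h
  have hij : ∀ z p, i z = j p → (z : V) = p ∧ (z : V) ∈ Q := fun z p h => by
    by_cases hq : (p : V) ∈ Q
    · rw [hjl p hq] at h
      have : (z : V) = p := congrArg Subtype.val (i.injective h)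
      exact ⟨this, this ▸ hq⟩
    · rw [hjr p hq] at h
      exact (Sum.inl_ne_inr h).elim
  let D := glue (M.induce Z) (M.induce P) i j
  have hcompat : ∀ a b, Finset.map i a = Finset.map j b →
      (a ∈ (M.induce Z).edges ↔ b ∈ (M.induce P).edges) := fun a b hab => by
    have h := congrArg (Finset.image π) hab
    rw [Finset.map_eq_image, Finset.map_eq_image, Finset.image_image, Finset.image_image] at h
    have h1 : a.image (π ∘ i) = a.map (Function.Embedding.subtype _) := by
      rw [Finset.map_eq_image]; rfl
    have h2 : b.image (π ∘ j) = b.map (Function.Embedding.subtype _) := by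
      rw [Finset.map_eq_image]; exact Finset.image_congr fun x _ => hπj x
    rw [M.induce_isEmbedding Z a, M.induce_isEmbedding P b, ← h1, ← h2, h]
  have hDi : (M.induce Z).IsEmbedding D i := glue_isEmbedding_left hcompat
  have hDj : (M.induce P).IsEmbedding D j := glue_isEmbedding_right hcompat
  have hsplit : D.Splits (Finset.univ.map j) (Finset.univ.map i) := glue_splits
  have hU : Finset.univ.map j ∪ Finset.univ.map i = (Finset.univ : Finset T) := by
    ext t
    simp only [Finset.mem_union, Finset.mem_map, Finset.mem_univ, true_and, iff_true]
    rcases t with z | ⟨p, hp, hq⟩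
    · exact Or.inr ⟨z, rfl⟩
    · exact Or.inl ⟨⟨p, hp⟩, hjr ⟨p, hp⟩ hq⟩
  obtain ⟨QP, hQP'⟩ := exists_map_subtype_eq hQP
  obtain ⟨QZ, hQZ'⟩ := exists_map_subtype_eq hQZ
  have memQP : ∀ p : P, p ∈ QP ↔ (p : V) ∈ Q := fun p => by rw [← hQP']; simp
  have memQZ : ∀ z : Z, z ∈ QZ ↔ (z : V) ∈ Q := fun z => by rw [← hQZ']; simp
  have hIP : Finset.univ.map j ∩ Finset.univ.map i = QP.map j := by
    ext t
    simp only [Finset.mem_inter, Finset.mem_map, Finset.mem_univ, true_and]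
    constructor
    · rintro ⟨⟨p, rfl⟩, ⟨z, hz⟩⟩
      have := hij z p hz
      exact ⟨p, (memQP p).2 (this.1 ▸ this.2), rfl⟩
    · rintro ⟨p, hp, rfl⟩
      exact ⟨⟨p, rfl⟩, ⟨⟨p, hQZ ((memQP p).1 hp)⟩, (hjl p ((memQP p).1 hp)).symm⟩⟩
  have hIZ : Finset.univ.map j ∩ Finset.univ.map i = QZ.map i := by
    ext t
    simp only [Finset.mem_inter, Finset.mem_map, Finset.mem_univ, true_and]
    constructor
    · rintro ⟨⟨p, hp⟩, ⟨z, rfl⟩⟩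
      exact ⟨z, (memQZ z).2 (hij z p hp.symm).2, rfl⟩
    · rintro ⟨z, hz, rfl⟩
      have hq := (memQZ z).1 hz
      exact ⟨⟨⟨z, hQP hq⟩, hjl ⟨z, hQP hq⟩ hq⟩, ⟨z, rfl⟩⟩
  have hsP : D.DStrong η (Finset.univ.map j ∩ Finset.univ.map i) (Finset.univ.map j) := by
    rw [hIP, hDj.dstrong_map_iff, ← (M.induce_isEmbedding P).dstrong_map_iff, hQP',
      univ_map_subtype]
    exact hQ P hQP
  have hsZ : D.DStrong η (Finset.univ.map j ∩ Finset.univ.map i) (Finset.univ.map i) := by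
    rw [hIZ, hDi.dstrong_map_iff, ← (M.induce_isEmbedding Z).dstrong_map_iff, hQZ',
      univ_map_subtype]
    exact hQ Z hQZ
  have hmem : D.MemCf η f Finset.univ := memCf_univ_of_splits ham D hU hsplit
    (hDj.memCf_map_iff.2 (memCf_induce_univ hM P)) (hDi.memCf_map_iff.2 (memCf_induce_univ hM Z))
    hsP hsZ
  have hZD : D.DStrong η (Finset.univ.map i) Finset.univ := by
    have := hsplit.symm.dstrong_union (by rw [Finset.inter_comm]) hsP
    rwa [Finset.union_comm _ (Finset.univ.map j), hU, Finset.union_eq_left.2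
      Finset.inter_subset_right] at this
  have hPD : D.DStrong η (Finset.univ.map j) Finset.univ := by
    have := hsplit.dstrong_union subset_rfl hsZ
    rwa [hU, Finset.union_eq_left.2 Finset.inter_subset_left] at this
  -- Realize `D` over `Z` in `M`; homogeneity then moves `P` to its copy.
  obtain ⟨ψ, hψ, hψi, hψcl⟩ := exists_extension hM hZ hmem hDi hZD
  have hθ : (M.induce P).IsEmbedding M (j.trans ψ) := hDj.trans hψ
  have hθcl : M.DClosed η (Finset.univ.map (j.trans ψ)) := by
    rw [← Finset.map_map]
    exact (hψ.dstrong_map_iff.2 hPD).dclosed hη hψcl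
  obtain ⟨hinj, hedge, him⟩ := injOn_and_image_mem_edges_iff hθ
  obtain ⟨g, hg⟩ := exists_automorphism_eqOn hM hP hinj hedge (him ▸ hθcl)
  have hgP : g • P = (Finset.univ.map j).map ψ := by
    rw [Finset.map_map, ← him, Finset.smul_finset_def]
    exact Finset.image_congr fun x hx => hg x hx
  have hZψ : Z = (Finset.univ.map i).map ψ := by
    ext x
    rw [Finset.map_map]
    simp only [Finset.mem_map, Finset.mem_univ, true_and, Function.Embedding.trans_apply, hψi]
    exact ⟨fun hx => ⟨⟨x, hx⟩, rfl⟩, by rintro ⟨z, rfl⟩; exact z.2⟩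
  have hgU : g • P ∪ Z = Finset.univ.map ψ := by
    rw [hgP]
    conv_lhs => rw [hZψ]
    rw [← Finset.map_union, hU]
  refine ⟨g, fun q hq => ?_, ?_, hgU ▸ hψcl, fun e he hsub => ?_⟩
  · rw [hg q (hQP hq)]
    have hj : j ⟨q, hQP hq⟩ = i ⟨q, hQZ hq⟩ := hjl ⟨q, hQP hq⟩ hq
    simp only [hQP hq, dif_pos, Function.Embedding.trans_apply, hj, hψi]
  · rw [hgP]
    conv_lhs => rw [hZψ]
    rw [← Finset.map_inter, hIZ, ← hQZ']
    ext x
    simp [hψi]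
  · rw [hgU] at hsub
    obtain ⟨u, -, rfl⟩ := Finset.subset_map_iff.1 hsub
    have := hsplit u ((hψ u).2 he) (by rw [hU]; exact Finset.subset_univ _)
    rw [hgP]
    conv => rhs; rw [hZψ]
    rwa [Finset.map_subset_map, Finset.map_subset_map]

end UniformHypergraph

namespace UniformHypergraph

variable {s : ℕ} {V : Type*} {M : UniformHypergraph s V} {η : ℝ} {f : ℝ≥0 → ℝ≥0} [DecidableEq V]

/-! ### Consequences of transitivity -/

theorem dclosed_empty_of_isPretransitive (hM : IsHrushovskiGeneric η f M) (hη : 0 ≤ η)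
    [Infinite V] [MulAction.IsPretransitive M.autGroup V] : M.DClosed η ∅ := by
  -- A closed set of least size lies in every closed set, so automorphisms preserve it.
  have hex : ∃ n, ∃ A, M.DClosed η A ∧ A.card = n := by
    obtain ⟨A, -, hA⟩ := exists_dclosed_superset hM ∅
    exact ⟨_, A, hA, rfl⟩
  classical
  obtain ⟨A, hA, hcard⟩ := Nat.find_spec hex
  have hmin : ∀ A', M.DClosed η A' → A ⊆ A' := fun A' hA' => by
    have h1 : Nat.find hex ≤ (A ∩ A').card := Nat.find_min' hex ⟨_, hA.inter hη hA', rfl⟩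
    exact Finset.inter_eq_left.1
      (Finset.eq_of_subset_of_card_le Finset.inter_subset_left (hcard.trans_le h1))
  rcases A.eq_empty_or_nonempty with rfl | ⟨a, ha⟩
  · exact hA
  · refine absurd (Set.finite_univ_iff.1 (A.finite_toSet.subset fun v _ => ?_))
      (not_finite_iff_infinite.2 ‹_›)
    obtain ⟨g, rfl⟩ := MulAction.exists_smul_eq M.autGroup a v
    have := hmin _ (hA.smul g⁻¹) ha
    rw [Finset.mem_inv_smul_finset_iff] at this
    exact this

theorem dclosed_singleton_of_isPretransitive (hM : IsHrushovskiGeneric η f M) (hη : 0 ≤ η)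
    [Infinite V] [MulAction.IsPretransitive M.autGroup V] (v : V) : M.DClosed η {v} := by
  have h0 := dclosed_empty_of_isPretransitive hM hη
  let ι : (∅ : Finset V) ↪ ({v} : Finset V) :=
    ⟨fun x => absurd x.2 (Finset.notMem_empty _), fun x => absurd x.2 (Finset.notMem_empty _)⟩
  have hι : (M.induce ∅).IsEmbedding (M.induce {v}) ι := fun e => by
    rw [Finset.eq_empty_of_isEmpty e, M.induce_isEmbedding, M.induce_isEmbedding {v}]
    simp
  obtain ⟨φ, -, -, hφ⟩ := exists_extension hM h0 (memCf_induce_univ hM {v}) hι (by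
    rw [← (M.induce_isEmbedding {v}).dstrong_map_iff, Finset.univ_eq_empty, Finset.map_empty,
      Finset.map_empty]
    exact h0 _ (Finset.empty_subset _))
  obtain ⟨g, hg⟩ := MulAction.exists_smul_eq M.autGroup (φ ⟨v, Finset.mem_singleton_self v⟩) v
  have h1 : Finset.univ.map φ = {φ ⟨v, Finset.mem_singleton_self v⟩} := by
    rw [Finset.univ_unique, Finset.map_singleton]; rfl
  rw [h1] at hφ
  have := hφ.smul g
  rwa [Finset.smul_finset_singleton, hg] at this

/-! ### Generation by two stabilizers in free position -/

/-- If `h • B` is in free position with respect to `B` over `∅`, then the stabilizers of `B` and of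
`h • B` generate the automorphism group in boundedly many steps. -/
theorem exists_eq_mul_of_free (hM : IsHrushovskiGeneric η f M) (hη : 0 ≤ η)
    (ham : HasFreeDAmalgamation s η f) {B : Finset V} (hB : M.DClosed η B) {h : M.autGroup}
    (hcl : M.DClosed η (h • B ∪ B)) (hsp : M.Splits (h • B) B) (hdisj : Disjoint (h • B) B)
    (g : M.autGroup) :
    ∃ k ∈ fixingSubgroup M.autGroup (B : Set V), ∃ u ∈ fixingSubgroup M.autGroup (B : Set V),
    ∃ v ∈ fixingSubgroup M.autGroup (B : Set V), g = k * h * u * h⁻¹ * v := by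
  obtain ⟨E, hE, hEcl⟩ := exists_dclosed_superset hM (B ∪ g • B)
  have hBE : B ⊆ E := Finset.subset_union_left.trans hE
  have hgBE : g • B ⊆ E := Finset.subset_union_right.trans hE
  obtain ⟨k, hk, hkE, hkcl, hksp⟩ :=
    exists_free_translate hM hη ham hB hcl hEcl Finset.subset_union_right hBE
  have hkB : k • B = B := by
    rw [Finset.smul_finset_def]
    exact (Finset.image_congr fun x hx => hk x hx).trans Finset.image_id
  -- `C` is the copy of `B` that is free from both `B` and `g • B`.
  set C := k • h • B with hC
  rw [Finset.smul_finset_union, hkB, ← hC] at hkE hkcl hksp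
  have hCB : Disjoint C B := by
    rw [← hkB, hC]; exact disjoint_smul_finset _ hdisj
  have hCE : Disjoint C E := Finset.disjoint_left.2 fun x hx hxE =>
    Finset.disjoint_left.1 hCB hx
      (hkE.subset (Finset.mem_inter.2 ⟨Finset.mem_union_left _ hx, hxE⟩))
  have hspCB : M.Splits C B := by
    have := hsp.smul k
    rwa [hkB] at this
  have hspCE : M.Splits C E := fun e he hsub => by
    rcases hksp e he (hsub.trans (Finset.union_subset_union_left Finset.subset_union_left)) with
      h' | h'
    · exact (hspCB e he h').imp_right fun h'' => h''.trans hBE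
    · exact Or.inr h'
  have hclCE : M.DClosed η (C ∪ E) := by
    rwa [Finset.union_assoc, Finset.union_eq_right.2 hBE] at hkcl
  have hclCg : M.DClosed η (C ∪ g • B) :=
    (hspCE.dstrong_union (by rw [Finset.disjoint_iff_inter_eq_empty.1 hCE]; simp)
      ((hB.smul g) E hgBE)).dclosed hη hclCE
  have hclCB : M.DClosed η (C ∪ B) :=
    (hspCE.dstrong_union (by rw [Finset.disjoint_iff_inter_eq_empty.1 hCE]; simp)
      (hB E hBE)).dclosed hη hclCE
  let θ : V → V := fun x => if x ∈ B then g • x else x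
  have hθB : ∀ x ∈ B, θ x = g • x := fun x hx => if_pos hx
  have hθC : ∀ x ∈ C, θ x = x := fun x hx => if_neg (Finset.disjoint_left.1 hCB hx)
  have hgC : ∀ x ∈ B, g • x ∉ C := fun x hx h' =>
    Finset.disjoint_left.1 hCE h' (hgBE (Finset.smul_mem_smul_finset hx))
  have himB : ∀ e ⊆ B, e.image θ = g • e := fun e he => by
    rw [Finset.smul_finset_def]; exact Finset.image_congr fun x hx => hθB x (he hx)
  have himC : ∀ e ⊆ C, e.image θ = e := fun e he =>
    (Finset.image_congr fun x hx => hθC x (he hx)).trans Finset.image_id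
  have hinj : Set.InjOn θ ↑(C ∪ B) := by
    intro x hx y hy hxy
    rcases Finset.mem_union.1 hx with hx | hx <;> rcases Finset.mem_union.1 hy with hy | hy
    · rwa [hθC x hx, hθC y hy] at hxy
    · rw [hθC x hx, hθB y hy] at hxy
      exact absurd (hxy ▸ hx) (hgC y hy)
    · rw [hθB x hx, hθC y hy] at hxy
      exact absurd (hxy ▸ hy) (hgC x hx)
    · rw [hθB x hx, hθB y hy] at hxy
      exact smul_left_cancel g hxy
  have himU : (C ∪ B).image θ = C ∪ g • B := by
    rw [Finset.image_union, himC C subset_rfl, himB B subset_rfl]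
  have hedges : ∀ e ⊆ C ∪ B, (e ∈ M.edges ↔ e.image θ ∈ M.edges) := by
    intro e he
    have hCor : e ⊆ C → (e ∈ M.edges ↔ e.image θ ∈ M.edges) := fun h' => by rw [himC e h']
    have hBor : e ⊆ B → (e ∈ M.edges ↔ e.image θ ∈ M.edges) := fun h' => by
      rw [himB e h', smul_mem_edges_iff]
    constructor
    · intro h'
      exact (hspCB e h' he).elim (fun h'' => (hCor h'').1 h') fun h'' => (hBor h'').1 h'
    · intro h'
      have hsub : e.image θ ⊆ C ∪ E := (Finset.image_subset_image he).trans
        (himU.le.trans (Finset.union_subset_union_right hgBE))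
      rcases hspCE _ h' hsub with h'' | h''
      · refine (hCor fun x hx => ?_).2 h'
        refine (Finset.mem_union.1 (he hx)).resolve_right fun hxB => ?_
        exact hgC x hxB (hθB x hxB ▸ h'' (Finset.mem_image_of_mem θ hx))
      · refine (hBor fun x hx => ?_).2 h'
        refine (Finset.mem_union.1 (he hx)).resolve_left fun hxC => ?_
        exact Finset.disjoint_left.1 hCE hxC (hθC x hxC ▸ h'' (Finset.mem_image_of_mem θ hx))
  obtain ⟨a, ha⟩ := exists_automorphism_eqOn hM hclCB hinj hedges (himU ▸ hclCg)
  refine ⟨k, (mem_fixingSubgroup_iff _).2 hk, h⁻¹ * k⁻¹ * a * k * h,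
    (mem_fixingSubgroup_iff _).2 fun b hb => ?_, k⁻¹ * (a⁻¹ * g), mul_mem
      (inv_mem ((mem_fixingSubgroup_iff _).2 hk)) ((mem_fixingSubgroup_iff _).2 fun b hb => ?_),
    by group⟩
  · have hbC : k • h • b ∈ C :=
      Finset.smul_mem_smul_finset (Finset.smul_mem_smul_finset hb)
    simp only [mul_smul]
    rw [ha _ (Finset.mem_union_left _ hbC), hθC _ hbC, inv_smul_smul, inv_smul_smul]
  · rw [mul_smul, inv_smul_eq_iff, ha b (Finset.mem_union_right _ hb), hθB b hb]

/-! ### Free position along long chains -/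

/-- Moving `B` alternately by its stabilizer and by an automorphism `w` with `w • B` disjoint from
`B` yields a chain of disjoint translates of `B`, each of which separates `B` from the last one
`h • B` within the closed union `Z` of the chain. Hence a set `X ⊆ Z` either avoids a separating
translate, or has at least as many points as there are steps. -/
theorem exists_chain_of_disjoint_smul (hM : IsHrushovskiGeneric η f M) (hη : 0 ≤ η)
    (ham : HasFreeDAmalgamation s η f) {B : Finset V} (hB : M.DClosed η B) {w : M.autGroup}
    (hw : Disjoint (w • B) B) (n : ℕ) :
    ∃ h ∈ ((fixingSubgroup M.autGroup (B : Set V) : Set M.autGroup) * {w}) ^ n, ∃ Z : Finset V,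
      M.DClosed η Z ∧ B ⊆ Z ∧ h • B ⊆ Z ∧ ∀ X ⊆ Z,
        (∃ L R, L ∪ R = Z ∧ M.Splits L R ∧ B ⊆ L ∧ h • B ⊆ R ∧ Disjoint X (L ∩ R)) ∨
          n ≤ (X \ h • B).card := by
  induction n with
  | zero => exact ⟨1, by simp, B, hB, subset_rfl, by simp, fun X _ => Or.inr (Nat.zero_le _)⟩
  | succ n ih =>
    obtain ⟨h, hh, Z, hZ, hBZ, hhZ, hsep⟩ := ih
    obtain ⟨P, hP, hPcl⟩ := exists_dclosed_superset hM (B ∪ w • B)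
    obtain ⟨g, hg, hgZ, hgcl, hgsp⟩ := exists_free_translate hM hη ham (hB.smul h) (hPcl.smul h) hZ
      (Finset.smul_finset_subset_smul_finset (Finset.subset_union_left.trans hP)) hhZ
    set P' := g • h • P
    have hghB : g • h • B = h • B := by
      rw [Finset.smul_finset_def]
      exact (Finset.image_congr fun x hx => hg x hx).trans Finset.image_id
    have hnew : (g * h * w) • B = g • h • w • B := by rw [mul_smul, mul_smul]
    have hnewP : (g * h * w) • B ⊆ P' := by
      rw [hnew]
      exact Finset.smul_finset_subset_smul_finset (Finset.smul_finset_subset_smul_finset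
        (Finset.subset_union_right.trans hP))
    have hnewZ : Disjoint ((g * h * w) • B) Z := by
      have hd : Disjoint (g • h • w • B) (g • h • B) :=
        disjoint_smul_finset _ (disjoint_smul_finset h hw)
      rw [hghB, ← hnew] at hd
      exact Finset.disjoint_left.2 fun x hx hxZ => Finset.disjoint_left.1 hd hx
        (hgZ.subset (Finset.mem_inter.2 ⟨hnewP hx, hxZ⟩))
    refine ⟨g * h * w, ?_, Z ∪ P', by rwa [Finset.union_comm],
      hBZ.trans Finset.subset_union_left, hnewP.trans Finset.subset_union_right, fun X hX => ?_⟩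
    · rw [pow_succ]
      refine Set.mem_mul.2 ⟨h, hh, h⁻¹ * g * h * w, Set.mul_mem_mul
        ((mem_fixingSubgroup_iff _).2 fun b hb => ?_) rfl, by group⟩
      rw [mul_smul, mul_smul, hg _ (Finset.smul_mem_smul_finset hb), inv_smul_smul]
    rcases hsep (X ∩ Z) Finset.inter_subset_right with ⟨L, R, hLR, hs, hBL, hhR, hd⟩ | hcard
    · refine Or.inl ⟨L, R ∪ P', by rw [← Finset.union_assoc, hLR], fun e he hsub => ?_, hBL,
        hnewP.trans Finset.subset_union_right, Finset.disjoint_left.2 fun x hxX hx => ?_⟩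
      · rw [← Finset.union_assoc, hLR] at hsub
        rcases hgsp.symm e he hsub with h' | h'
        · exact (hs e he (hLR ▸ h')).imp_right fun h'' => h''.trans Finset.subset_union_left
        · exact Or.inr (h'.trans Finset.subset_union_right)
      · obtain ⟨hxL, hxRP⟩ := Finset.mem_inter.1 hx
        have hxZ : x ∈ Z := hLR ▸ Finset.mem_union_left _ hxL
        have hxR : x ∈ R := (Finset.mem_union.1 hxRP).elim id fun hxP =>
          hhR (hgZ.subset (Finset.mem_inter.2 ⟨hxP, hxZ⟩))
        exact Finset.disjoint_left.1 hd (Finset.mem_inter.2 ⟨hxX, hxZ⟩)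
          (Finset.mem_inter.2 ⟨hxL, hxR⟩)
    · by_cases hX' : Disjoint X (h • B)
      · refine Or.inl ⟨Z, P', rfl, hgsp.symm, hBZ, hnewP, ?_⟩
        rwa [Finset.inter_comm, hgZ]
      · obtain ⟨y, hyX, hyB⟩ := Finset.not_disjoint_iff.1 hX'
        refine Or.inr (hcard.trans_lt (Finset.card_lt_card
          (Finset.ssubset_iff_subset_ne.2 ⟨fun x hx => ?_, fun heq => ?_⟩)))
        · rw [Finset.mem_sdiff, Finset.mem_inter] at hx
          exact Finset.mem_sdiff.2
            ⟨hx.1.1, fun h' => Finset.disjoint_left.1 hnewZ h' hx.1.2⟩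
        · have : y ∈ X \ (g * h * w) • B := Finset.mem_sdiff.2
            ⟨hyX, fun h' => Finset.disjoint_left.1 hnewZ h' (hhZ hyB)⟩
          rw [← heq] at this
          exact (Finset.mem_sdiff.1 this).2 hyB

/-- If the number of steps of the chain exceeds the size of all sets of predimension at most
`2|B|`, then the closure of `B ∪ h • B` avoids a separating set, and so `B` and `h • B` are in
free position. -/
theorem free_of_separated (hη : 0 ≤ η) {B Z : Finset V} (hB : M.DClosed η B) (hZ : M.DClosed η Z)
    {h : M.autGroup} (hBZ : B ⊆ Z) (hhZ : h • B ⊆ Z)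
    (hsep : ∀ X ⊆ Z, M.predim η X ≤ (2 * B.card : ℕ) →
      ∃ L R, L ∪ R = Z ∧ M.Splits L R ∧ B ⊆ L ∧ h • B ⊆ R ∧ Disjoint X (L ∩ R)) :
    M.DClosed η (h • B ∪ B) ∧ M.Splits (h • B) B ∧ Disjoint (h • B) B := by
  have hle : M.predim η (h • B ∪ B) ≤ (2 * B.card : ℕ) := by
    refine (M.predim_le_card hη _).trans (Nat.cast_le.2 ((Finset.card_union_le _ _).trans ?_))
    rw [Finset.card_smul_finset, two_mul]
  have hUZ : h • B ∪ B ⊆ Z := Finset.union_subset hhZ hBZ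
  obtain ⟨hsp, hdisj⟩ : M.Splits (h • B) B ∧ Disjoint (h • B) B := by
    obtain ⟨L, R, hLR, hs, hBL, hhR, hd⟩ := hsep _ hUZ hle
    refine ⟨fun e he hsub => ?_, Finset.disjoint_left.2 fun x hx hxB => ?_⟩
    · rcases hs e he (hsub.trans (hUZ.trans hLR.ge)) with h' | h'
      · refine Or.inr fun x hx => (Finset.mem_union.1 (hsub hx)).resolve_left fun hxh => ?_
        exact Finset.disjoint_left.1 hd (hsub hx) (Finset.mem_inter.2 ⟨h' hx, hhR hxh⟩)
      · refine Or.inl fun x hx => (Finset.mem_union.1 (hsub hx)).resolve_right fun hxB => ?_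
        exact Finset.disjoint_left.1 hd (hsub hx) (Finset.mem_inter.2 ⟨hBL hxB, h' hx⟩)
    · exact Finset.disjoint_left.1 hd (Finset.mem_union_left _ hx)
        (Finset.mem_inter.2 ⟨hBL hxB, hhR hx⟩)
  refine ⟨dclosed_iff.2 fun X hX => ?_, hsp, hdisj⟩
  by_contra! hlt
  have hXZ := hZ.predim_inter_le hη X
  have hUX : h • B ∪ B ⊆ X ∩ Z := Finset.subset_inter hX.1 hUZ
  obtain ⟨L, R, hLR, hs, hBL, hhR, hd⟩ :=
    hsep (X ∩ Z) Finset.inter_subset_right (hXZ.trans (hlt.trans hle))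
  have hBX : B ⊆ X ∩ Z ∩ L := Finset.subset_inter (Finset.subset_union_right.trans hUX) hBL
  have hhX : h • B ⊆ X ∩ Z ∩ R := Finset.subset_inter (Finset.subset_union_left.trans hUX) hhR
  have e0 := hsp.predim_add_eq (η := η) subset_rfl
  have e1 := hs.predim_add_eq (η := η) (X := X ∩ Z) (by rw [hLR]; exact Finset.inter_subset_right)
  have i1 : X ∩ Z ∩ L ∩ R = ∅ := by
    rw [Finset.inter_assoc]; exact Finset.disjoint_iff_inter_eq_empty.1 hd
  have i2 : (h • B ∪ B) ∩ h • B ∩ B = ∅ := by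
    rw [Finset.inter_assoc, Finset.disjoint_iff_inter_eq_empty.1 hdisj, Finset.inter_empty]
  rw [i2, Finset.union_inter_cancel_left, Finset.union_inter_cancel_right] at e0
  rw [i1] at e1
  have l1 := hB.predim_le hBX
  have l2 := (hB.smul h).predim_le hhX
  -- All these inequalities are equalities, and strictness of closedness forces `X = h • B ∪ B`.
  have hXsub : X ⊆ Z := by
    by_contra h'
    have := hZ.predim_inter_lt hη h'
    linarith
  have q1 : B = X ∩ Z ∩ L := by
    by_contra h'
    have := dclosed_iff.1 hB _ (Finset.ssubset_iff_subset_ne.2 ⟨hBX, h'⟩)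
    linarith
  have q2 : h • B = X ∩ Z ∩ R := by
    by_contra h'
    have := dclosed_iff.1 (hB.smul h) _ (Finset.ssubset_iff_subset_ne.2 ⟨hhX, h'⟩)
    linarith
  refine hX.2 fun x hx => ?_
  have hxZ := hXsub hx
  rcases Finset.mem_union.1 (hLR.ge hxZ) with h' | h'
  · exact Finset.mem_union_right _ (q1.ge (by simp [hx, hxZ, h']))
  · exact Finset.mem_union_left _ (q2.ge (by simp [hx, hxZ, h']))

end UniformHypergraph

/-! ### The standard topology -/

section StandardTopology

variable {Ω : Type*} (G : Subgroup (Equiv.Perm Ω))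

theorem isOpen_standardTopology_setOf_smul_eq (a b : Ω) :
    IsOpen[standardTopology G] {h : G | h • a = b} := by
  by_cases hab : ∃ g : G, g • a = b
  · obtain ⟨g, rfl⟩ := hab
    refine TopologicalSpace.isOpen_generateFrom_of_mem ⟨g, {a}, ?_⟩
    ext h
    simp [Subgroup.smul_def]
  · have : {h : G | h • a = b} = ∅ := Set.eq_empty_of_forall_notMem fun h hh => hab ⟨h, hh⟩
    rw [this]
    exact @isOpen_empty _ (standardTopology G)

theorem continuous_standardTopology_iff {X : Type*} [TopologicalSpace X] {F : X → G} :
    Continuous[_, standardTopology G] F ↔ ∀ a b : Ω, IsOpen {x | F x • a = b} := by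
  constructor
  · intro hF a b
    let _ := standardTopology G
    exact (isOpen_standardTopology_setOf_smul_eq G a b).preimage hF
  · intro hF
    refine continuous_generateFrom_iff.2 ?_
    rintro _ ⟨g, A, rfl⟩
    have : F ⁻¹' {h : G | ∀ a ∈ A, (h : Equiv.Perm Ω) a = (g : Equiv.Perm Ω) a}
        = ⋂ a ∈ A, {x | F x • a = g • a} := by
      ext x; simp [Subgroup.smul_def]
    rw [this]
    exact isOpen_biInter_finset fun a _ => hF a _

theorem isTopologicalGroup_standardTopology :
    @IsTopologicalGroup G (standardTopology G) _ := by
  let _ := standardTopology G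
  have hmul : Continuous fun p : G × G => p.1 * p.2 :=
    (continuous_standardTopology_iff G).2 fun a b => by
      have : {p : G × G | (p.1 * p.2) • a = b}
          = ⋃ c, {x : G | x • c = b} ×ˢ {y : G | y • a = c} := by
        ext p; simp [mul_smul]
      rw [this]
      exact isOpen_iUnion fun c => (isOpen_standardTopology_setOf_smul_eq G c b).prod
        (isOpen_standardTopology_setOf_smul_eq G a c)
  have hinv : Continuous fun x : G => x⁻¹ :=
    (continuous_standardTopology_iff G).2 fun a b => by
      have : {x : G | x⁻¹ • a = b} = {x : G | x • b = a} := by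
        ext x; exact inv_smul_eq_iff.trans eq_comm
      rw [this]
      exact isOpen_standardTopology_setOf_smul_eq G b a
  exact { continuous_mul := hmul, continuous_inv := hinv }

theorem t2Space_standardTopology : @T2Space G (standardTopology G) := by
  let _ := standardTopology G
  refine ⟨fun x y hxy => ?_⟩
  obtain ⟨a, ha⟩ : ∃ a : Ω, x • a ≠ y • a := by
    by_contra! h
    exact hxy (Subtype.ext (Equiv.ext h))
  refine ⟨{h | h • a = x • a}, {h | h • a = y • a}, isOpen_standardTopology_setOf_smul_eq G _ _,
    isOpen_standardTopology_setOf_smul_eq G _ _, rfl, rfl, Set.disjoint_left.2 fun h h1 h2 => ?_⟩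
  exact ha (h1.symm.trans h2)

/-- The cosets of pointwise stabilizers of finite sets are a basis, not only a subbasis. -/
theorem exists_finset_of_mem_isOpen_standardTopology {U : Set G}
    (hU : IsOpen[standardTopology G] U) {x : G} (hx : x ∈ U) :
    ∃ A : Finset Ω, ∀ y : G, (∀ a ∈ A, y • a = x • a) → y ∈ U := by
  classical
  induction hU with
  | basic U hU =>
    obtain ⟨g, A, rfl⟩ := hU
    exact ⟨A, fun y hy a ha => (hy a ha).trans (hx a ha)⟩
  | univ => exact ⟨∅, fun _ _ => trivial⟩
  | inter U₁ U₂ _ _ ih₁ ih₂ =>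
    obtain ⟨A₁, h₁⟩ := ih₁ hx.1
    obtain ⟨A₂, h₂⟩ := ih₂ hx.2
    exact ⟨A₁ ∪ A₂, fun y hy => ⟨h₁ y fun a ha => hy a (Finset.mem_union_left _ ha),
      h₂ y fun a ha => hy a (Finset.mem_union_right _ ha)⟩⟩
  | sUnion S _ ih =>
    obtain ⟨U, hUS, hxU⟩ := hx
    obtain ⟨A, hA⟩ := ih U hUS hxU
    exact ⟨A, fun y hy => ⟨U, hUS, hA y hy⟩⟩

theorem exists_fixingSubgroup_subset_of_mem_nhds_one {σ : TopologicalSpace G}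
    (hσ : standardTopology G ≤ σ) {U : Set G} (hU : U ∈ 𝓝 (1 : G)) :
    ∃ A : Finset Ω, (fixingSubgroup G (A : Set Ω) : Set G) ⊆ U := by
  obtain ⟨t, htU, ht, h1⟩ := mem_nhds_iff.1 hU
  obtain ⟨A, hA⟩ := exists_finset_of_mem_isOpen_standardTopology G (hσ t ht) h1
  exact ⟨A, fun x hx => htU (hA x fun a ha => by
    rw [(mem_fixingSubgroup_iff G).1 hx a ha, one_smul])⟩

/-- A group topology in which all point stabilizers are open is finer than the standard one. -/
theorem le_standardTopology {σ : TopologicalSpace G} (hG : @IsTopologicalGroup G σ _)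
    (hst : ∀ a : Ω, (MulAction.stabilizer G a : Set G) ∈ @nhds G σ 1) :
    σ ≤ standardTopology G := by
  refine continuous_id_iff_le.1 ((continuous_standardTopology_iff G).2 fun a b => ?_)
  refine isOpen_iff_mem_nhds.2 fun x hx => ?_
  have h1 : (fun y : G => x⁻¹ * y) ⁻¹' (MulAction.stabilizer G a : Set G) ∈ 𝓝 x := by
    refine (continuous_const.mul continuous_id).continuousAt.preimage_mem_nhds ?_
    simpa using hst a
  filter_upwards [h1] with y hy
  have : (x⁻¹ * y) • a = a := hy
  rw [mul_smul, inv_smul_eq_iff] at this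
  exact this.trans hx

end StandardTopology

namespace UniformHypergraph

variable {s : ℕ} {V : Type*} {M : UniformHypergraph s V} {η : ℝ} {f : ℝ≥0 → ℝ≥0}

/-! ### Coarser group topologies -/

section Coarser

variable [TopologicalSpace M.autGroup]

theorem exists_dclosed_fixing_subset [DecidableEq V] (hM : IsHrushovskiGeneric η f M)
    (hst : ∀ U ∈ 𝓝 (1 : M.autGroup), ∃ A : Finset V,
      (fixingSubgroup M.autGroup (A : Set V) : Set M.autGroup) ⊆ U)
    {U : Set M.autGroup}
    (hU : U ∈ 𝓝 1) (F : Finset V) : ∃ B, M.DClosed η B ∧ F ⊆ B ∧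
      (fixingSubgroup M.autGroup (B : Set V) : Set M.autGroup) ⊆ U := by
  obtain ⟨A, hA⟩ := hst U hU
  obtain ⟨B, hB, hcl⟩ := exists_dclosed_superset hM (F ∪ A)
  refine ⟨B, hcl, Finset.subset_union_left.trans hB, fun x hx => hA ?_⟩
  exact (mem_fixingSubgroup_iff _).2 fun y hy =>
    (mem_fixingSubgroup_iff _).1 hx y (hB (Finset.mem_union_right _ hy))

variable [IsTopologicalGroup M.autGroup]

theorem conj_mem_nhds_one (g : M.autGroup) {U : Set M.autGroup} (hU : U ∈ 𝓝 1) :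
    {x | g⁻¹ * x * g ∈ U} ∈ 𝓝 (1 : M.autGroup) := by
  have : Continuous fun x : M.autGroup => g⁻¹ * x * g := by fun_prop
  refine this.continuousAt.preimage_mem_nhds ?_
  simpa using hU

theorem exists_nhds_one_pow_subset {U : Set M.autGroup} (hU : U ∈ 𝓝 1) (n : ℕ) :
    ∃ W ∈ 𝓝 (1 : M.autGroup), W ^ n ⊆ U := by
  induction n generalizing U with
  | zero => exact ⟨U, hU, by simpa using mem_of_mem_nhds hU⟩
  | succ n ih =>
    obtain ⟨W₁, hW₁o, hW₁, hmul⟩ := exists_open_nhds_one_mul_subset hU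
    obtain ⟨W₂, hW₂, hpow⟩ := ih (hW₁o.mem_nhds hW₁)
    refine ⟨W₁ ∩ W₂, Filter.inter_mem (hW₁o.mem_nhds hW₁) hW₂, ?_⟩
    rw [pow_succ]
    exact (Set.mul_subset_mul ((Set.pow_subset_pow_left Set.inter_subset_right).trans hpow)
      Set.inter_subset_left).trans hmul

variable [DecidableEq V]

/-- If the point stabilizer is not a neighbourhood of `1`, then neighbourhoods of `1` have infinite
orbits: a neighbourhood with a least finite orbit `F` of `a` contains another one that preserves
`F`, and intersecting it with its conjugate by `g`, where `F ∩ g • F = {a}`, gives a neighbourhood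
fixing `a`. -/
theorem exists_smul_notMem (hM : IsHrushovskiGeneric η f M) (hη : 0 ≤ η)
    (ham : HasFreeDAmalgamation s η f) {a : V} (ha : M.DClosed η {a})
    (hno : (MulAction.stabilizer M.autGroup a : Set M.autGroup) ∉ 𝓝 1)
    {W : Set M.autGroup} (hW : W ∈ 𝓝 1) (F : Finset V) : ∃ w ∈ W, w • a ∉ F := by
  by_contra! hF
  have hex : ∃ n, ∃ F : Finset V, F.card = n ∧ ∃ W ∈ 𝓝 (1 : M.autGroup), ∀ w ∈ W, w • a ∈ F :=
    ⟨_, F, rfl, W, hW, hF⟩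
  classical
  obtain ⟨F₀, hcard, W₀, hW₀, hWF⟩ := Nat.find_spec hex
  obtain ⟨U, hUo, hU1, hmul⟩ := exists_open_nhds_one_split hW₀
  have hU : U ∈ 𝓝 1 := hUo.mem_nhds hU1
  have hUW : U ⊆ W₀ := fun u hu => by simpa using hmul u hu 1 hU1
  have hmin : Nat.find hex ≤ (F₀.filter fun x => ∃ u ∈ U, u • a = x).card :=
    Nat.find_min' hex ⟨_, rfl, U, hU, fun u hu =>
      Finset.mem_filter.2 ⟨hWF u (hUW hu), u, hu, rfl⟩⟩
  have hfilter := Finset.eq_of_subset_of_card_le (Finset.filter_subset _ _) (hcard.trans_le hmin)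
  have hpres : ∀ u ∈ U, ∀ x ∈ F₀, u • x ∈ F₀ := fun u hu x hx => by
    rw [← hfilter] at hx
    obtain ⟨-, u', hu', rfl⟩ := Finset.mem_filter.1 hx
    rw [← mul_smul]
    exact hWF _ (hmul u hu u' hu')
  have haF : a ∈ F₀ := by simpa using hWF 1 (hUW hU1)
  obtain ⟨P, hFP, hP⟩ := exists_dclosed_superset hM F₀
  have haP : {a} ⊆ P := Finset.singleton_subset_iff.2 (hFP haF)
  obtain ⟨g, hg, hgP, -, -⟩ := exists_free_translate hM hη ham ha hP hP haP haP
  have hga : g • a = a := hg a (Finset.mem_singleton_self a)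
  refine hno (Filter.mem_of_superset (Filter.inter_mem hU (conj_mem_nhds_one g hU)) ?_)
  rintro x ⟨hx, hx' : g⁻¹ * x * g ∈ U⟩
  have h1 : x • a ∈ P := hFP (hpres x hx a haF)
  have h2 : x • a ∈ g • P := by
    have := hFP (hpres _ hx' a haF)
    rw [mul_smul, hga, mul_smul] at this
    exact Finset.inv_smul_mem_iff.1 this
  exact Finset.mem_singleton.1 (hgP.subset (Finset.mem_inter.2 ⟨h2, h1⟩))

/-- Every neighbourhood of `1` moves any finite set off any other. -/
theorem exists_disjoint_smul (hM : IsHrushovskiGeneric η f M) (hη : 0 ≤ η)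
    (ham : HasFreeDAmalgamation s η f) (hone : ∀ a : V, M.DClosed η {a})
    (hno : ∀ a : V, (MulAction.stabilizer M.autGroup a : Set M.autGroup) ∉ 𝓝 1)
    (hst : ∀ U ∈ 𝓝 (1 : M.autGroup), ∃ A : Finset V,
      (fixingSubgroup M.autGroup (A : Set V) : Set M.autGroup) ⊆ U)
    {W : Set M.autGroup} (hW : W ∈ 𝓝 1) (S D : Finset V) :
    ∃ h ∈ W, Disjoint (h • S) D := by
  induction S using Finset.induction_on generalizing W D with
  | empty => exact ⟨1, mem_of_mem_nhds hW, by simp⟩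
  | insert b S _ ih =>
    obtain ⟨U, hU, hpow⟩ := exists_nhds_one_pow_subset hW 3
    obtain ⟨B, hB, hDB, hBU⟩ := exists_dclosed_fixing_subset hM hst hU D
    obtain ⟨h, hh, hhS⟩ := ih hU B
    have h1 : (1 : M.autGroup) ∈ U := mem_of_mem_nhds hU
    have hmem : ∀ x ∈ U, ∀ y ∈ U, ∀ z ∈ U, x * y * z ∈ W := fun x hx y hy z hz =>
      hpow (by
        rw [pow_succ, pow_two]
        exact Set.mul_mem_mul (Set.mul_mem_mul hx hy) hz)
    by_cases hb : h • b ∈ B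
    · obtain ⟨w, hw, hwb⟩ := exists_smul_notMem hM hη ham (hone (h • b)) (hno _) hU D
      obtain ⟨P, hP, hPcl⟩ := exists_dclosed_superset hM (B ∪ h • S)
      obtain ⟨Z, hZ, hZcl⟩ := exists_dclosed_superset hM (B ∪ w⁻¹ • D)
      -- `k` moves `h • S` away from the preimage of `D` under `w`, and keeps `h • b`.
      obtain ⟨k, hk, hkZ, -, -⟩ := exists_free_translate hM hη ham hB hPcl hZcl
        (Finset.subset_union_left.trans hP) (Finset.subset_union_left.trans hZ)
      refine ⟨w * k * h, hmem w hw k (hBU ((mem_fixingSubgroup_iff _).2 hk)) h hh,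
        Finset.disjoint_left.2 fun x hx hxD => ?_⟩
      obtain ⟨y, hy, rfl⟩ := Finset.mem_smul_finset.1 hx
      simp only [mul_smul] at hxD
      rcases Finset.mem_insert.1 hy with rfl | hy
      · rw [hk _ hb] at hxD
        exact hwb hxD
      · have hyS : h • y ∈ h • S := Finset.smul_mem_smul_finset hy
        have hyZ : k • h • y ∈ Z := hZ (Finset.mem_union_right _
          (Finset.mem_inv_smul_finset_iff.2 hxD))
        have hyB : k • h • y ∈ B := hkZ.subset (Finset.mem_inter.2
          ⟨Finset.smul_mem_smul_finset (hP (Finset.mem_union_right _ hyS)), hyZ⟩)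
        have : h • y = k • h • y := smul_left_cancel k (hk _ hyB).symm
        exact Finset.disjoint_left.1 hhS hyS (this ▸ hyB)
    · refine ⟨h, by simpa using hmem h hh 1 h1 1 h1, ?_⟩
      rw [Finset.smul_finset_insert, Finset.disjoint_insert_left]
      exact ⟨fun h' => hb (hDB h'), hhS.mono_right hDB⟩

/-- Every neighbourhood of `1` moves any closed set to a copy in free position. -/
theorem exists_free_smul (hM : IsHrushovskiGeneric η f M) (hη : 0 ≤ η)
    (hf : IsGoodFunction s η f) (hone : ∀ a : V, M.DClosed η {a})
    (hno : ∀ a : V, (MulAction.stabilizer M.autGroup a : Set M.autGroup) ∉ 𝓝 1)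
    (hst : ∀ U ∈ 𝓝 (1 : M.autGroup), ∃ A : Finset V,
      (fixingSubgroup M.autGroup (A : Set V) : Set M.autGroup) ⊆ U)
    {U : Set M.autGroup} (hU : U ∈ 𝓝 1) {B : Finset V} (hB : M.DClosed η B) :
    ∃ h ∈ U, M.DClosed η (h • B ∪ B) ∧ M.Splits (h • B) B ∧ Disjoint (h • B) B := by
  obtain ⟨n, hn⟩ := exists_card_lt_of_predim_le hM hf.tendsto (2 * B.card)
  -- The length of the chain depends only on `B`, and is fixed before the neighbourhood.
  obtain ⟨W, hW, hWU⟩ := exists_nhds_one_pow_subset hU (2 * n)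
  obtain ⟨B', hB', hBB', hfix⟩ := exists_dclosed_fixing_subset hM hst hW B
  obtain ⟨w, hw, hdisj⟩ := exists_disjoint_smul hM hη hf.amalgamation hone hno hst hW B' B'
  obtain ⟨h, hh, Z, hZ, hBZ, hhZ, hsep⟩ :=
    exists_chain_of_disjoint_smul hM hη hf.amalgamation hB' hdisj n
  have hhB : h • B ⊆ h • B' := Finset.smul_finset_subset_smul_finset hBB'
  refine ⟨h, hWU ?_, free_of_separated hη hB hZ (hBB'.trans hBZ) (hhB.trans hhZ)
    fun X hXZ hX => ?_⟩
  · rw [pow_mul, pow_two]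
    exact Set.pow_subset_pow_left
      (Set.mul_subset_mul hfix (Set.singleton_subset_iff.2 hw)) hh
  · rcases hsep X hXZ with ⟨L, R, h1, h2, h3, h4, h5⟩ | hcard
    · exact ⟨L, R, h1, h2, hBB'.trans h3, hhB.trans h4, h5⟩
    · have := (hcard.trans (Finset.card_le_card Finset.sdiff_subset)).trans_lt (hn X hX)
      exact absurd this (lt_irrefl _)

/-- Point stabilizers are open in every Hausdorff group topology coarser than the standard one. -/
theorem stabilizer_mem_nhds_one [T2Space M.autGroup] [MulAction.IsPretransitive M.autGroup V]
    (hM : IsHrushovskiGeneric η f M) (hη : 0 ≤ η) (hf : IsGoodFunction s η f)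
    (hone : ∀ a : V, M.DClosed η {a})
    (hst : ∀ U ∈ 𝓝 (1 : M.autGroup), ∃ A : Finset V,
      (fixingSubgroup M.autGroup (A : Set V) : Set M.autGroup) ⊆ U) (a : V) :
    (MulAction.stabilizer M.autGroup a : Set M.autGroup) ∈ 𝓝 1 := by
  by_contra ha
  have hno : ∀ b : V, (MulAction.stabilizer M.autGroup b : Set M.autGroup) ∉ 𝓝 1 := by
    intro b hb
    obtain ⟨g, rfl⟩ := MulAction.exists_smul_eq M.autGroup b a
    refine ha (Filter.mem_of_superset (conj_mem_nhds_one g hb) fun x hx => ?_)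
    have : (g⁻¹ * x * g) • b = b := hx
    rwa [mul_smul, mul_smul, inv_smul_eq_iff] at this
  -- Every neighbourhood of `1` is then the whole group.
  have hall : ∀ U ∈ 𝓝 (1 : M.autGroup), ∀ g, g ∈ U := by
    intro U hU g
    obtain ⟨W₀, hW₀, hpow⟩ := exists_nhds_one_pow_subset hU 5
    have hW : W₀ ∩ W₀⁻¹ ∈ 𝓝 (1 : M.autGroup) := Filter.inter_mem hW₀ (inv_mem_nhds_one _ hW₀)
    obtain ⟨B, hB, -, hfix⟩ := exists_dclosed_fixing_subset hM hst hW ∅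
    obtain ⟨h, hh, hcl, hsp, hdisj⟩ := exists_free_smul hM hη hf hone hno hst hW hB
    obtain ⟨k, hk, u, hu, v, hv, rfl⟩ :=
      exists_eq_mul_of_free hM hη hf.amalgamation hB hcl hsp hdisj g
    refine hpow ?_
    rw [pow_succ, pow_succ, pow_succ, pow_two]
    exact Set.mul_mem_mul (Set.mul_mem_mul (Set.mul_mem_mul (Set.mul_mem_mul (hfix hk).1 hh.1)
      (hfix hu).1) hh.2) (hfix hv).1
  refine ha (Filter.mem_of_superset Filter.univ_mem fun g _ => ?_)
  have hg : g = 1 := by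
    by_contra hg
    exact hall _ (isOpen_compl_singleton.mem_nhds (Ne.symm hg)) g rfl
  rw [hg]
  exact one_mem _

end Coarser

end UniformHypergraph

theorem mainTheorem9 {V : Type*} (s : ℕ) (hs : 2 ≤ s) (η : ℝ) (hη : η ∈ Set.Ioc (0 : ℝ) 1)
    (f : ℝ≥0 → ℝ≥0) (hf : IsGoodFunction s η f)
    (M : UniformHypergraph s V) (hM : IsHrushovskiGeneric η f M)
    (htrans : MulAction.IsPretransitive M.autGroup V) :
    IsMinimalTopologicalGroup M.autGroup (standardTopology M.autGroup) := by
  classical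
  refine ⟨isTopologicalGroup_standardTopology _, t2Space_standardTopology _,
    fun σ hσ hT2 hle => le_antisymm (le_standardTopology _ hσ fun a => ?_) hle⟩
  rcases finite_or_infinite V with hV | hV
  · have : DiscreteTopology M.autGroup := inferInstance
    exact (isOpen_discrete _).mem_nhds (one_mem _)
  · exact UniformHypergraph.stabilizer_mem_nhds_one hM hη.1.le hf
      (UniformHypergraph.dclosed_singleton_of_isPretransitive hM hη.1.le)
      (fun U hU => exists_fixingSubgroup_subset_of_mem_nhds_one _ hle hU) a
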